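/- Let $H$ be an infinite-dimensional separable complex Hilbert space and let $p,q\in[1,\infty]$ be conjugate, i.e. $\frac1p+\frac1q=1$. For $1\le p<\infty$ let $\mathcal B^p(H)$ be the Schatten class of compact operators on $H$ whose singular numbers are $p$-summable, and let $\mathcal B^\infty(H)$ be the set of all compact operators. Let $C\in\mathcal B^p(H)$ and $T\in\mathcal B^q(H)$ be self-adjoint, with positive and negative parts $C^\pm,T^\pm$ (so $C=C^+-C^-$, $T=T^+-T^-$ with $C^\pm,T^\pm\ge 0$ and $C^+C^-=0=T^+T^-$). For a positive semi-definite compact operator $A$ let $(\lambda_j^\downarrow(A))_{j\ge1}$ be the decreasing sequence of its non-zero eigenvalues, repeated according to multiplicity and filled up with zeros if there are only finitely many of them. Then for every unitary $U$ on $H$ the trace $\operatorname{tr}(CU^*TU)$ is well defined (the defining series converges in every orthonormal basis, to the same value) and real, the series below converge, and $$\sup_{U\text{ unitary}}\operatorname{tr}(CU^*TU)=\sum_{j=1}^\infty\big(\lambda_j^\downarrow(C^+)\lambda_j^\downarrow(T^+)+\lambda_j^\downarrow(C^-)\lambda_j^\downarrow(T^-)\big),$$ $$\inf_{U\text{ unitary}}\operatorname{tr}(CU^*TU)=-\sum_{j=1}^\infty\big(\lambda_j^\downarrow(C^+)\lambda_j^\downarrow(T^-)+\lambda_j^\downarrow(C^-)\lambda_j^\downarrow(T^+)\big).$$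 In particular, $$-\sum_{j=1}^\infty\big(\lambda_j^\downarrow(C^+)\lambda_j^\downarrow(T^-)+\lambda_j^\downarrow(C^-)\lambda_j^\downarrow(T^+)\big)\le\operatorname{tr}(CT)\le\sum_{j=1}^\infty\big(\lambda_j^\downarrow(C^+)\lambda_j^\downarrow(T^+)+\lambda_j^\downarrow(C^-)\lambda_j^\downarrow(T^-)\big).$$ -/

import Mathlib

open scoped ENNReal

noncomputable section

namespace SchattenVonNeumann

variable {H : Type*} [NormedAddCommGroup H] [InnerProductSpace ℂ H]

/-- The `n`-th (`n = 0, 1, …`) entry of the decreasing sequence of the positive eigenvalues of a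
compact self-adjoint operator `A`, repeated according to multiplicity and filled up with zeros.
It is the largest `μ > 0` such that more than `n` eigenvalues of `A`, counted with multiplicity,
are at least `μ`, and it is `0` (the supremum of the empty set) if there is no such `μ`. For
compact `A` and `μ > 0` the span of the eigenspaces below is finite-dimensional. -/
def eigDown (A : H →L[ℂ] H) (n : ℕ) : ℝ :=
  sSup {μ : ℝ | 0 < μ ∧
    n < Module.finrank ℂ
      (⨆ ν ∈ Set.Ici μ, Module.End.eigenspace (A : H →ₗ[ℂ] H) ((ν : ℝ) : ℂ) : Submodule ℂ H)}

/-- The `n`-th (`n = 0, 1, …`) singular number of a compact operator `C`: the square root of the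
`n`-th eigenvalue of `C† C`, in decreasing order. -/
def singularNumber [CompleteSpace H] (C : H →L[ℂ] H) (n : ℕ) : ℝ :=
  Real.sqrt (eigDown (star C * C) n)

/-- Membership in the Schatten class `B^p(H)`: compact operators with `p`-summable singular
numbers if `p < ∞`, and all compact operators if `p = ∞`. -/
def IsSchatten [CompleteSpace H] (p : ℝ≥0∞) (C : H →L[ℂ] H) : Prop :=
  IsCompactOperator C ∧ (p ≠ ∞ → Summable fun n : ℕ => singularNumber C n ^ p.toReal)

/-- The trace `∑ i, ⟪b i, A (b i)⟫`, computed in a fixed orthonormal (Hilbert) basis, the set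
`(exists_hilbertBasis ℂ H).choose` of vectors. (The value is meaningful if the sum converges for
every orthonormal basis, to the same value.) -/
def opTrace [CompleteSpace H] (A : H →L[ℂ] H) : ℂ :=
  ∑' i : (exists_hilbertBasis ℂ H).choose, inner ℂ (i : H) (A (i : H))

end SchattenVonNeumann

end

/-!
Everything reduces to positive compact operators `A`, `B`. By the spectral theorem
(`exists_hasExpansion`) such an operator is `A x = ∑ n, a n • ⟪e n, x⟫ • e n` with `e` orthonormal
and `a = eigDown A` decreasing to zero; infinite dimension allows a finite-rank operator to be padded
with arbitrary orthonormal vectors.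

The trace of `A B` is treated by a layer cake decomposition (`HasExpansion.hasSum_layers`): with
`P k` the projection onto the span of `e 0, …, e k`, Abel summation gives
`A = ∑ k, (a k - a (k + 1)) • P k`, and likewise `B = ∑ l, (b l - b (l + 1)) • Q l`. In every
orthonormal basis `v` the sum `∑ i, |⟪v i, P k (Q l (v i))⟫|` is at most `min k l + 1`
(`tsum_enorm_inner_truncProj_le`), and
`∑ k, ∑ l, (a k - a (k + 1)) (b l - b (l + 1)) (min k l + 1) = ∑ j, a j * b j`. So the trace series
becomes an absolutely convergent triple series, and its sum
`tr (A B) = ∑ n, ∑ m, a n * b m * |⟪e n, f m⟫|²` does not depend on the basis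
(`HasExpansion.hasSum_trace`). The same interchange of sums yields von Neumann's inequality
`tr (A B) ≤ ∑ j, a j * b j` (`weightedSum_le`). Convergence of `∑ j, a j * b j` is Hölder's
inequality, because the eigenvalues of `C⁺` and `C⁻` are dominated by the singular numbers of `C`.

For self-adjoint `C` and `T` the trace splits into four such terms. The two mixed terms are
nonpositive, which gives the upper bound. For the converse a unitary is chosen that maps the
leading `n` eigenvectors of `C⁺`, `C⁻` to those of `T⁺`, `T⁻`
(`SignedExpansion.exists_unitary_le_traceValue`). The two main terms are then at least the partial
sums of the right-hand side, and the mixed terms only see pairs of indices with one of them at least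
`n`, so that von Neumann's inequality bounds them by series of shifted sequences such as
`∑ j, a (j + n) * b j`, which tend to zero by dominated convergence. The infimum follows
by exchanging `T⁺` and `T⁻`.
-/

noncomputable section

namespace SchattenVonNeumann

open Filter Topology

/-! ### Decreasing rearrangement of a null family -/

/-- The `n`-th entry of the decreasing rearrangement of the positive values of a family `l` of real
numbers: the largest `μ > 0` such that more than `n` members of the family are at least `μ`, and
`0` if there is none. It is meaningful if, for every `μ > 0`, only finitely many members of the
family are at least `μ`. -/
def decRearr {I : Type*} (l : I → ℝ) (n : ℕ) : ℝ :=
  sSup {μ : ℝ | 0 < μ ∧ n < Set.ncard {i | μ ≤ l i}}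

section Rearrangement

variable {I : Type*} {l : I → ℝ}

lemma decRearr_nonneg (l : I → ℝ) (n : ℕ) : 0 ≤ decRearr l n :=
  Real.sSup_nonneg fun _ hμ => hμ.1.le

lemma bddAbove_decRearr_set (hfin : ∀ μ, 0 < μ → {i | μ ≤ l i}.Finite) (n : ℕ) :
    BddAbove {μ : ℝ | 0 < μ ∧ n < Set.ncard {i | μ ≤ l i}} := by
  obtain ⟨M, hM⟩ := ((hfin 1 one_pos).image l).bddAbove
  refine ⟨max 1 M, fun μ hμ => ?_⟩
  have hne : {i | μ ≤ l i}.Nonempty := by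
    refine Set.nonempty_of_ncard_ne_zero ?_
    have := hμ.2
    omega
  obtain ⟨i, hi⟩ := hne
  rcases le_total μ 1 with h | h
  · exact le_max_of_le_left h
  · exact le_max_of_le_right ((show μ ≤ l i from hi).trans
      (hM ⟨i, h.trans hi, rfl⟩))

lemma le_decRearr_iff (hfin : ∀ μ, 0 < μ → {i | μ ≤ l i}.Finite) {ν : ℝ} (hν : 0 < ν) (n : ℕ) :
    ν ≤ decRearr l n ↔ n < Set.ncard {i | ν ≤ l i} := by
  refine ⟨fun h => ?_, fun h => le_csSup (bddAbove_decRearr_set hfin n) ⟨hν, h⟩⟩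
  -- Only finitely many members lie in `[ν / 2, ν)`, so some `ν' < ν` has the same superlevel set.
  have hF : {i | ν / 2 ≤ l i ∧ l i < ν}.Finite :=
    (hfin (ν / 2) (by positivity)).subset fun i hi => hi.1
  have h1 : ∀ᶠ ν' in 𝓝[<] ν, ∀ i ∈ {i | ν / 2 ≤ l i ∧ l i < ν}, l i < ν' :=
    (eventually_all_finite hF).2 fun i hi =>
      mem_of_superset (Ioo_mem_nhdsLT hi.2) fun x hx => hx.1
  have h2 : ∀ᶠ ν' in 𝓝[<] ν, ν' ∈ Set.Ioo (ν / 2) ν := Ioo_mem_nhdsLT (by linarith)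
  obtain ⟨ν', h1, h2⟩ := (h1.and h2).exists
  have hne : {μ : ℝ | 0 < μ ∧ n < Set.ncard {i | μ ≤ l i}}.Nonempty := by
    by_contra hne
    have h0 : decRearr l n = 0 := by
      rw [decRearr, Set.not_nonempty_iff_eq_empty.1 hne, Real.sSup_empty]
    linarith
  obtain ⟨μ, hμ, hνμ⟩ := exists_lt_of_lt_csSup hne (h2.2.trans_le (show ν ≤ sSup _ from h))
  refine hμ.2.trans_le (Set.ncard_le_ncard (fun i hi => ?_) (hfin ν hν))
  by_contra hlt
  have hlt' : l i < ν := not_le.1 hlt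
  have hi' : μ ≤ l i := hi
  have := h1 i ⟨by linarith [h2.1], hlt'⟩
  linarith

lemma lt_decRearr_iff (hfin : ∀ μ, 0 < μ → {i | μ ≤ l i}.Finite) {ν : ℝ} (hν : 0 < ν) (n : ℕ) :
    ν < decRearr l n ↔ n < Set.ncard {i | ν < l i} := by
  have hF : {i | ν < l i}.Finite := (hfin ν hν).subset fun i (hi : ν < l i) => hi.le
  -- For `ν' > ν` close to `ν`, being at least `ν'` is the same as exceeding `ν`.
  have h1 : ∀ᶠ ν' in 𝓝[>] ν, ∀ i ∈ {i | ν < l i}, ν' < l i :=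
    (eventually_all_finite hF).2 fun i hi =>
      mem_of_superset (Ioo_mem_nhdsGT hi) fun x hx => hx.2
  have key : ∀ᶠ ν' in 𝓝[>] ν, ν < ν' ∧ (ν' ≤ decRearr l n ↔ n < Set.ncard {i | ν < l i}) := by
    filter_upwards [h1, self_mem_nhdsWithin] with ν' h1 (h2 : ν < ν')
    have : {i | ν < l i} = {i | ν' ≤ l i} :=
      Set.Subset.antisymm (fun i hi => (h1 i hi).le) fun i hi => h2.trans_le hi
    rw [this]
    exact ⟨h2, le_decRearr_iff hfin (hν.trans h2) n⟩
  constructor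
  · intro h
    have h3 : ∀ᶠ ν' in 𝓝[>] ν, ν' ∈ Set.Ioo ν (decRearr l n) := Ioo_mem_nhdsGT h
    obtain ⟨ν', h4, h5⟩ := (key.and h3).exists
    exact h4.2.1 h5.2.le
  · intro h
    obtain ⟨ν', h4⟩ := key.exists
    exact h4.1.trans_le (h4.2.2 h)

lemma antitone_decRearr (hfin : ∀ μ, 0 < μ → {i | μ ≤ l i}.Finite) : Antitone (decRearr l) := by
  intro m n hmn
  rcases (decRearr_nonneg l n).eq_or_lt with h | h
  · rw [← h]; exact decRearr_nonneg l m
  · exact (le_decRearr_iff hfin h m).2 (hmn.trans_lt ((le_decRearr_iff hfin h n).1 le_rfl))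

lemma tendsto_decRearr (hfin : ∀ μ, 0 < μ → {i | μ ≤ l i}.Finite) :
    Tendsto (decRearr l) atTop (𝓝 0) := by
  rw [Metric.tendsto_atTop]
  intro ε hε
  refine ⟨Set.ncard {i | ε ≤ l i}, fun n hn => ?_⟩
  rw [Real.dist_0_eq_abs, abs_of_nonneg (decRearr_nonneg l n)]
  by_contra! h
  exact absurd ((le_decRearr_iff hfin hε n).1 h) (by omega)

/-- The decreasing rearrangement of a positive null family lists exactly the members of the family,
with multiplicity. -/
lemma exists_equiv_decRearr (hfin : ∀ μ, 0 < μ → {i | μ ≤ l i}.Finite) (hpos : ∀ i, 0 < l i) :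
    ∃ σ : {n // 0 < decRearr l n} ≃ I, ∀ n, l (σ n) = decRearr l n := by
  -- Both sides have fibres of the same finite cardinality over each `ν > 0`.
  have hfib : ∀ ν : Set.Ioi (0 : ℝ), Nonempty
      ({n : {n // 0 < decRearr l n} // (⟨decRearr l n, n.2⟩ : Set.Ioi (0 : ℝ)) = ν} ≃
        {i : I // (⟨l i, hpos i⟩ : Set.Ioi (0 : ℝ)) = ν}) := by
    rintro ⟨ν, hν : 0 < ν⟩
    have hset : {n | decRearr l n = ν} =
        Set.Ico (Set.ncard {i | ν < l i}) (Set.ncard {i | ν ≤ l i}) := by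
      ext n
      have h1 := le_decRearr_iff hfin hν n
      have h2 := lt_decRearr_iff hfin hν n
      simp only [Set.mem_ofPred_eq, Set.mem_Ico, ← h1, ← not_lt (b := Set.ncard _), ← h2]
      rw [not_lt, and_comm, ← le_antisymm_iff, eq_comm]
    have hF1 : {i | l i = ν}.Finite := (hfin ν hν).subset fun i hi => (hi : l i = ν).ge
    have hF2 : {i | ν < l i}.Finite := (hfin ν hν).subset fun i (hi : ν < l i) => hi.le
    have hun : {i | ν ≤ l i} = {i | ν < l i} ∪ {i | l i = ν} := by
      ext i
      simp [le_iff_lt_or_eq, eq_comm]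
    have hcard : Set.ncard {i | ν ≤ l i} = Set.ncard {i | ν < l i} + Set.ncard {i | l i = ν} := by
      rw [hun, Set.ncard_union_eq _ hF2 hF1]
      rw [Set.disjoint_left]
      intro i (hi : ν < l i) (hi' : l i = ν)
      exact hi.ne' hi'
    have hnc : Set.ncard {n | decRearr l n = ν} = Set.ncard {i | l i = ν} := by
      rw [hset, hcard, ← Finset.coe_Ico, Set.ncard_coe_finset]
      simp
    have hF3 : {n | decRearr l n = ν}.Finite := by rw [hset]; exact Set.finite_Ico _ _
    have i1 := hF1.to_subtype
    have i3 := hF3.to_subtype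
    have e : {n | decRearr l n = ν} ≃ {i | l i = ν} := (Finite.card_eq.1 hnc).some
    exact ⟨{ toFun := fun n => ⟨(e ⟨n.1.1, congrArg Subtype.val n.2⟩).1,
                Subtype.ext (e ⟨n.1.1, congrArg Subtype.val n.2⟩).2⟩
             invFun := fun i => ⟨⟨(e.symm ⟨i.1, congrArg Subtype.val i.2⟩).1, by
                have : decRearr l _ = ν := (e.symm ⟨i.1, congrArg Subtype.val i.2⟩).2
                rw [this]; exact hν⟩,
                Subtype.ext (e.symm ⟨i.1, congrArg Subtype.val i.2⟩).2⟩
             left_inv := fun n => by simp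
             right_inv := fun i => by simp }⟩
  let E := fun ν => (hfib ν).some
  let σ : {n // 0 < decRearr l n} ≃ I :=
    (Equiv.sigmaFiberEquiv (fun n : {n // 0 < decRearr l n} =>
      (⟨decRearr l n, n.2⟩ : Set.Ioi (0 : ℝ)))).symm.trans
      ((Equiv.sigmaCongrRight E).trans
        (Equiv.sigmaFiberEquiv fun i : I => (⟨l i, hpos i⟩ : Set.Ioi (0 : ℝ))))
  refine ⟨σ, fun n => ?_⟩
  exact congrArg Subtype.val (E ⟨decRearr l n, n.2⟩ ⟨n, rfl⟩).2

end Rearrangement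

/-! ### Eigenvalue expansions of positive compact operators -/

section Expansions

open Module.End

variable {H : Type*} [NormedAddCommGroup H] [InnerProductSpace ℂ H]

/-- The expansion `A x = ∑ n, a n • ⟪e n, x⟫ • e n` of a positive compact operator along an
orthonormal sequence `e`, with a sequence of coefficients decreasing to zero. If `A` has finite
rank, the vectors `e n` with `a n = 0` are arbitrary. -/
structure HasExpansion (A : H →L[ℂ] H) (a : ℕ → ℝ) (e : ℕ → H) : Prop where
  orthonormal : Orthonormal ℂ e
  antitone : Antitone a
  tendsto : Tendsto a atTop (𝓝 0)
  hasSum : ∀ x, HasSum (fun n => (a n : ℂ) • (inner ℂ (e n) x : ℂ) • e n) (A x)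

namespace HasExpansion
variable {A : H →L[ℂ] H} {a : ℕ → ℝ} {e : ℕ → H}

lemma nonneg (h : HasExpansion A a e) (n : ℕ) : 0 ≤ a n :=
  h.antitone.le_of_tendsto h.tendsto n

lemma apply_eq (h : HasExpansion A a e) (n : ℕ) : A (e n) = (a n : ℂ) • e n := by
  have h1 := hasSum_single (f := fun m => (a m : ℂ) • (inner ℂ (e m) (e n) : ℂ) • e m) n
    fun m hm => by simp [h.orthonormal.2 hm]
  rw [(h.hasSum (e n)).unique h1]
  simp [h.orthonormal.1 n, inner_self_eq_norm_sq_to_K]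

end HasExpansion

/-- The span of the eigenspaces of `A` for the eigenvalues that are at least `μ`. -/
def eigSpan (A : H →L[ℂ] H) (μ : ℝ) : Submodule ℂ H :=
  ⨆ ν ∈ Set.Ici μ, Module.End.eigenspace (A : H →ₗ[ℂ] H) ((ν : ℝ) : ℂ)

lemma eigDown_nonneg (A : H →L[ℂ] H) (n : ℕ) : 0 ≤ eigDown A n :=
  Real.sSup_nonneg fun _ hμ => hμ.1.le

/-- In an infinite-dimensional Hilbert space, finitely many prescribed orthonormal members of a
countable family can be completed to an orthonormal family. -/
lemma exists_orthonormal_extension [CompleteSpace H] (hdim : ¬ FiniteDimensional ℂ H) {ι : Type*}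
    [Countable ι] (v : ι → H) (S : Set ι) (hS : S.Finite)
    (hv : Orthonormal ℂ fun i : S => v i) :
    ∃ g : ι → H, Orthonormal ℂ g ∧ ∀ i ∈ S, g i = v i := by
  classical
  obtain ⟨w, b, hsw, hb⟩ := hv.toSubtypeRange.exists_hilbertBasis_extension
  have hinf : w.Infinite := by
    intro hw
    have := hw.fintype
    exact hdim (Module.Basis.finiteDimensional_of_finite b.toOrthonormalBasis.toBasis)
  have hfin : (Set.range fun i : S => v i).Finite := by
    have := hS.to_subtype
    exact Set.finite_range _
  have hinf' := (hinf.sdiff hfin).to_subtype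
  obtain ⟨c, hc⟩ := exists_injective_nat ι
  let φ : ι ↪ ↥(w \ Set.range fun i : S => v i) :=
    (⟨c, hc⟩ : ι ↪ ℕ).trans (Infinite.natEmbedding _)
  let G : ι → w := fun i =>
    if h : i ∈ S then ⟨v i, hsw ⟨⟨i, h⟩, rfl⟩⟩ else ⟨φ i, (φ i).2.1⟩
  have hG : Function.Injective G := by
    intro i j hij
    by_cases hi : i ∈ S <;> by_cases hj : j ∈ S
    · simp only [G, hi, hj, dif_pos, Subtype.mk.injEq] at hij
      have := hv.linearIndependent.injective (a₁ := ⟨i, hi⟩) (a₂ := ⟨j, hj⟩) hij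
      exact congrArg Subtype.val this
    · simp only [G, hi, hj, dif_pos, dif_neg, not_false_eq_true, Subtype.mk.injEq] at hij
      exact absurd ⟨⟨i, hi⟩, hij⟩ (φ j).2.2
    · simp only [G, hi, hj, dif_pos, dif_neg, not_false_eq_true, Subtype.mk.injEq] at hij
      exact absurd ⟨⟨j, hj⟩, hij.symm⟩ (φ i).2.2
    · simp only [G, hi, hj, dif_neg, not_false_eq_true, Subtype.mk.injEq] at hij
      exact φ.injective (Subtype.ext hij)
  refine ⟨fun i => b (G i), b.orthonormal.comp G hG, fun i hi => ?_⟩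
  simp [hb, G, hi]

section Eigenbasis

variable {A : H →L[ℂ] H}

/-- A compact operator cannot have infinitely many orthonormal eigenvectors with eigenvalues
bounded away from zero. -/
lemma finite_eigenvalue_ge (hc : IsCompactOperator A) {I : Type*} {b : I → H} {l : I → ℝ}
    (hb : Orthonormal ℂ b) (hA : ∀ i, A (b i) = (l i : ℂ) • b i) (μ : ℝ) (hμ : 0 < μ) :
    {i | μ ≤ l i}.Finite := by
  by_contra hinf
  have := Set.Infinite.to_subtype hinf
  let f := Infinite.natEmbedding {i | μ ≤ l i}
  obtain ⟨K, hK, hAK⟩ := hc.image_closedBall_subset_compact (f := (A : H →ₗ[ℂ] H)) 1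
  have hmem : ∀ n, A (b (f n)) ∈ K := fun n =>
    hAK ⟨b (f n), by simp [hb.1], rfl⟩
  obtain ⟨x, -, φ, hφ, hlim⟩ := hK.tendsto_subseq hmem
  have hcs := hlim.cauchySeq
  rw [Metric.cauchySeq_iff] at hcs
  obtain ⟨N, hN⟩ := hcs μ hμ
  have hlt := hN N le_rfl (N + 1) (Nat.le_succ N)
  have hne : (f (φ N) : I) ≠ f (φ (N + 1)) := fun h =>
    absurd (f.injective (Subtype.ext h)) (hφ (Nat.lt_succ_self N)).ne
  have horth : inner ℂ (b (f (φ N))) (b (f (φ (N + 1)))) = 0 := hb.2 hne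
  -- The inner product with `b (f (φ N))` already detects the distance `μ`.
  have h1 : inner ℂ (b (f (φ N))) (A (b (f (φ N))) - A (b (f (φ (N + 1))))) =
      (l (f (φ N)) : ℂ) := by
    rw [hA, hA, inner_sub_right, inner_smul_right, inner_smul_right, horth,
      inner_self_eq_norm_sq_to_K, hb.1]
    simp
  have h2 := norm_inner_le_norm (𝕜 := ℂ) (b (f (φ N))) (A (b (f (φ N))) - A (b (f (φ (N + 1)))))
  rw [h1, hb.1, one_mul, Complex.norm_real] at h2
  have h3 : μ ≤ l (f (φ N)) := (f (φ N)).2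
  have h4 : dist (A (b (f (φ N)))) (A (b (f (φ (N + 1))))) < μ := hlt
  rw [dist_eq_norm] at h4
  linarith [le_abs_self (l (f (φ N))), Real.norm_eq_abs (l (f (φ N)))]

/-- The positive eigenvalues of a positive compact operator, listed along an orthonormal family
whose members span the eigenspaces. -/
structure EigenFamily (A : H →L[ℂ] H) (I : Type*) (b : I → H) (l : I → ℝ) : Prop where
  orthonormal : Orthonormal ℂ b
  pos : ∀ i, 0 < l i
  finite : ∀ μ, 0 < μ → {i | μ ≤ l i}.Finite
  apply_eq : ∀ i, A (b i) = (l i : ℂ) • b i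
  eigenspace_eq : ∀ ν : ℝ, 0 < ν →
    eigenspace (A : H →ₗ[ℂ] H) (ν : ℂ) = Submodule.span ℂ (b '' {i | l i = ν})

lemma exists_eigenFamily [CompleteSpace H] (hc : IsCompactOperator A) (hA : A.IsPositive) :
    ∃ (I : Type) (b : I → H) (l : I → ℝ), EigenFamily A I b l := by
  have hfd : ∀ ν : Set.Ioi (0 : ℝ),
      FiniteDimensional ℂ (eigenspace (A : H →ₗ[ℂ] H) ((ν : ℝ) : ℂ)) := fun ν =>
    A.finite_dimensional_eigenspace hc _ (by exact_mod_cast (ne_of_gt ν.2))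
  let β := fun ν : Set.Ioi (0 : ℝ) =>
    stdOrthonormalBasis ℂ (eigenspace (A : H →ₗ[ℂ] H) ((ν : ℝ) : ℂ))
  have hof := hA.isSymmetric.orthogonalFamily_eigenspaces
  have hof' := hof.comp (γ := Set.Ioi (0 : ℝ)) (f := fun ν => ((ν : ℝ) : ℂ))
    fun x y h => Subtype.ext (Complex.ofReal_injective h)
  have hon := hof'.orthonormal_sigma_orthonormal (v_family := fun ν => β ν)
    fun ν => (β ν).orthonormal
  have hap : ∀ i : Σ ν : Set.Ioi (0 : ℝ), Fin (Module.finrank ℂ (eigenspace (A : H →ₗ[ℂ] H)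
      ((ν : ℝ) : ℂ))), A ((β i.1 i.2 : _) : H) = ((i.1 : ℝ) : ℂ) • ((β i.1 i.2 : _) : H) :=
    fun i => mem_eigenspace_iff.1 (β i.1 i.2).2
  refine ⟨Σ ν : Set.Ioi (0 : ℝ), Fin (Module.finrank ℂ (eigenspace (A : H →ₗ[ℂ] H)
      ((ν : ℝ) : ℂ))), fun i => (β i.1 i.2 : _), fun i => i.1, ?_⟩
  refine ⟨hon, fun i => i.1.2, fun μ hμ => finite_eigenvalue_ge hc hon hap μ hμ, hap, ?_⟩
  intro ν hν
  apply le_antisymm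
  · have h1 := (β ⟨ν, hν⟩).toBasis.span_eq
    have h2 := congrArg (Submodule.map (Submodule.subtype _)) h1
    rw [Submodule.map_span, Submodule.map_top, Submodule.range_subtype] at h2
    refine h2.symm.le.trans (Submodule.span_mono ?_)
    rintro _ ⟨_, ⟨j, rfl⟩, rfl⟩
    exact ⟨⟨⟨ν, hν⟩, j⟩, rfl, by simp⟩
  · rw [Submodule.span_le]
    rintro _ ⟨i, hi, rfl⟩
    have hi' : (i.1 : ℝ) = ν := hi
    subst hi'
    exact (β i.1 i.2).2

namespace EigenFamily

variable {I : Type*} {b : I → H} {l : I → ℝ}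

lemma eigSpan_eq (h : EigenFamily A I b l) {μ : ℝ} (hμ : 0 < μ) :
    eigSpan A μ = Submodule.span ℂ (b '' {i | μ ≤ l i}) := by
  apply le_antisymm
  · refine iSup₂_le fun ν (hν : μ ≤ ν) => ?_
    rw [h.eigenspace_eq ν (hμ.trans_le hν)]
    refine Submodule.span_mono (Set.image_mono ?_)
    intro i (hi : l i = ν)
    exact hν.trans hi.ge
  · rw [Submodule.span_le]
    rintro _ ⟨i, hi, rfl⟩
    refine Submodule.mem_iSup_of_mem (l i) (Submodule.mem_iSup_of_mem hi ?_)
    exact mem_eigenspace_iff.2 (h.apply_eq i)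

lemma finiteDimensional_eigSpan (h : EigenFamily A I b l) {μ : ℝ} (hμ : 0 < μ) :
    FiniteDimensional ℂ (eigSpan A μ) := by
  rw [h.eigSpan_eq hμ]
  exact FiniteDimensional.span_of_finite ℂ ((h.finite μ hμ).image b)

lemma finrank_eigSpan (h : EigenFamily A I b l) {μ : ℝ} (hμ : 0 < μ) :
    Module.finrank ℂ (eigSpan A μ) = Set.ncard {i | μ ≤ l i} := by
  have := (h.finite μ hμ).fintype
  have hli : LinearIndependent ℂ fun i : {i | μ ≤ l i} => b i :=
    (h.orthonormal.comp _ Subtype.val_injective).linearIndependent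
  rw [h.eigSpan_eq hμ, Set.image_eq_range, finrank_span_eq_card hli, ← Nat.card_eq_fintype_card]
  rfl

lemma eigDown_eq (h : EigenFamily A I b l) : eigDown A = decRearr l := by
  ext n
  unfold eigDown decRearr
  congr 1
  ext μ
  refine and_congr_right fun hμ => ?_
  rw [← h.finrank_eigSpan hμ]
  rfl

lemma hasSum [CompleteSpace H] (h : EigenFamily A I b l) (hc : IsCompactOperator A)
    (hA : A.IsPositive) (x : H) :
    HasSum (fun i => (l i : ℂ) • (inner ℂ (b i) x : ℂ) • b i) (A x) := by
  obtain ⟨w, B, hsw, hB⟩ := h.orthonormal.toSubtypeRange.exists_hilbertBasis_extension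
  -- Vectors orthogonal to the family are orthogonal to all eigenspaces of nonzero eigenvalues, so
  -- the spectral theorem puts them into the kernel.
  have hker : ∀ v, (∀ i, inner ℂ v (b i) = 0) → A v = 0 := by
    intro v hv
    have h0 := A.orthogonalComplement_iSup_eigenspaces_eq_bot hc hA.isSymmetric
    rw [← Submodule.mem_bot ℂ, ← h0, Submodule.mem_orthogonal']
    intro u hu
    induction hu using Submodule.iSup_induction' with
    | zero => simp
    | add x y _ _ hx hy => rw [inner_add_right, hx, hy, add_zero]
    | mem μ u hu =>
      have hsym : inner ℂ (A v) u = inner ℂ v (A u) := hA.isSymmetric v u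
      have hu' : A u = μ • u := mem_eigenspace_iff.1 hu
      rw [hsym, hu', inner_smul_right]
      by_cases hu0 : u = 0
      · simp [hu0]
      by_cases hμ0 : μ = 0
      · simp [hμ0]
      have hev : HasEigenvalue (A : H →ₗ[ℂ] H) μ := hasEigenvalue_of_hasEigenvector ⟨hu, hu0⟩
      have hreal : ((μ.re : ℝ) : ℂ) = μ :=
        Complex.conj_eq_iff_re.1 (hA.isSymmetric.conj_eigenvalue_eq_self hev)
      rw [← hreal] at hev hu
      have hnn : 0 ≤ μ.re := eigenvalue_nonneg_of_nonneg hev fun x =>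
        (RCLike.nonneg_iff.1 (hA.inner_nonneg_right x)).1
      have hpos : 0 < μ.re := lt_of_le_of_ne hnn fun h' => hμ0 (by rw [← hreal, ← h']; simp)
      rw [h.eigenspace_eq _ hpos] at hu
      have : inner ℂ v u = 0 := by
        clear hsym hu' hu0
        induction hu using Submodule.span_induction with
        | mem y hy => obtain ⟨i, -, rfl⟩ := hy; exact hv i
        | zero => simp
        | add y z _ _ hy hz => rw [inner_add_right, hy, hz, add_zero]
        | smul c y _ hy => rw [inner_smul_right, hy, mul_zero]
      rw [this, mul_zero]
  have hs := (B.hasSum_repr x).mapL A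
  let f : I → w := fun i => ⟨b i, hsw ⟨i, rfl⟩⟩
  have hf : Function.Injective f := fun i j hij =>
    h.orthonormal.linearIndependent.injective (congrArg Subtype.val hij)
  rw [← hf.hasSum_iff] at hs
  · convert! hs using 1
    ext i
    simp only [Function.comp_apply, map_smul, B.repr_apply_apply, hB, f, h.apply_eq]
    rw [smul_comm]
  · intro v hv
    rw [map_smul, hker (B v), smul_zero]
    intro i
    have hne : v ≠ f i := fun h' => hv ⟨i, h'.symm⟩
    have := B.orthonormal.2 hne
    simpa [hB, f] using this

end EigenFamily

/-- The spectral theorem, with the eigenvalues in the order given by `eigDown`. -/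
lemma exists_hasExpansion [CompleteSpace H] (hdim : ¬ FiniteDimensional ℂ H)
    (hc : IsCompactOperator A) (hA : A.IsPositive) : ∃ e, HasExpansion A (eigDown A) e := by
  obtain ⟨I, b, l, h⟩ := exists_eigenFamily hc hA
  rw [h.eigDown_eq]
  set a := decRearr l with ha
  obtain ⟨σ, hσ⟩ : ∃ σ : {n // 0 < a n} ≃ I, ∀ n, l (σ n) = a n :=
    exists_equiv_decRearr h.finite h.pos
  have hanti : Antitone a := antitone_decRearr h.finite
  have hlim : Tendsto a atTop (𝓝 0) := tendsto_decRearr h.finite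
  have hbσ : Orthonormal ℂ fun n : {n | 0 < a n} => b (σ n) := h.orthonormal.comp _ σ.injective
  obtain ⟨e, he, hes⟩ : ∃ e : ℕ → H, Orthonormal ℂ e ∧ ∀ n : {n | 0 < a n}, e n = b (σ n) := by
    by_cases hall : ∀ n, 0 < a n
    · exact ⟨fun n => b (σ ⟨n, hall n⟩), h.orthonormal.comp _ fun m n hmn =>
        congrArg Subtype.val (σ.injective hmn), fun n => rfl⟩
    · push Not at hall
      obtain ⟨N, hN⟩ := hall
      have hfin : {n | 0 < a n}.Finite := by
        refine (Set.finite_lt_nat N).subset fun n (hn : 0 < a n) => ?_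
        by_contra hnN
        exact absurd (hn.trans_le ((hanti (not_lt.1 hnN)).trans hN)) (lt_irrefl _)
      classical
      obtain ⟨g, hg, hgs⟩ := exists_orthonormal_extension hdim
        (fun n => if hn : n ∈ {n | 0 < a n} then b (σ ⟨n, hn⟩) else 0) _ hfin (by
          convert! hbσ using 2 with n
          exact dif_pos n.2)
      exact ⟨g, hg, fun n => (hgs n n.2).trans (dif_pos n.2)⟩
  refine ⟨e, he, hanti, hlim, fun x => ?_⟩
  have hs := h.hasSum hc hA x
  rw [← σ.hasSum_iff] at hs
  refine (hasSum_subtype_iff_of_support_subset (s := {n | 0 < a n}) ?_).1 ?_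
  · intro n hn
    refine lt_of_le_of_ne (decRearr_nonneg l n) fun h0 => hn ?_
    have h0' : a n = 0 := h0.symm
    simp [h0']
  · convert! hs using 1
    ext n
    simp only [Function.comp_apply]
    rw [hes n, hσ]

lemma le_eigDown_iff [CompleteSpace H] (hc : IsCompactOperator A) (hA : A.IsPositive) {μ : ℝ}
    (hμ : 0 < μ) (n : ℕ) :
    μ ≤ eigDown A n ↔ n < Module.finrank ℂ (eigSpan A μ) := by
  obtain ⟨I, b, l, h⟩ := exists_eigenFamily hc hA
  rw [h.eigDown_eq, le_decRearr_iff h.finite hμ, h.finrank_eigSpan hμ]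

lemma finiteDimensional_eigSpan [CompleteSpace H] (hc : IsCompactOperator A) (hA : A.IsPositive)
    {μ : ℝ} (hμ : 0 < μ) : FiniteDimensional ℂ (eigSpan A μ) := by
  obtain ⟨I, b, l, h⟩ := exists_eigenFamily hc hA
  exact h.finiteDimensional_eigSpan hμ

end Eigenbasis

end Expansions

/-! ### Von Neumann's inequality for doubly substochastic matrices -/

/-- The sum of the terms of `α` from index `n` on. -/
def tailSum (α : ℕ → ℝ≥0∞) (n : ℕ) : ℝ≥0∞ := ∑' k, if n ≤ k then α k else 0

/-- Interchanging the order of summation writes a double sum weighted by tail sums as a sum over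
the upper left corners of the matrix `s`. -/
lemma tsum_tailSum_mul (α β : ℕ → ℝ≥0∞) (s : ℕ → ℕ → ℝ≥0∞) :
    ∑' n, ∑' m, tailSum α n * tailSum β m * s n m =
      ∑' k, ∑' l, α k * β l *
        ∑ n ∈ Finset.range (k + 1), ∑ m ∈ Finset.range (l + 1), s n m := by
  have h1 : ∀ n m, tailSum α n * tailSum β m * s n m =
      ∑' k, ∑' l, α k * β l * (if n ≤ k then if m ≤ l then s n m else 0 else 0) := by
    intro n m
    unfold tailSum
    rw [← ENNReal.tsum_mul_right, ← ENNReal.tsum_mul_right]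
    refine tsum_congr fun k => ?_
    rw [mul_assoc, ← ENNReal.tsum_mul_right, ← ENNReal.tsum_mul_left]
    refine tsum_congr fun l => ?_
    split_ifs <;> ring
  have h2 : ∀ k l, ∑ n ∈ Finset.range (k + 1), ∑ m ∈ Finset.range (l + 1), s n m =
      ∑' n, ∑' m, (if n ≤ k then if m ≤ l then s n m else 0 else 0) := by
    intro k l
    rw [tsum_eq_sum (s := Finset.range (k + 1))]
    · refine Finset.sum_congr rfl fun n hn => ?_
      have hn' : n ≤ k := Nat.lt_succ_iff.1 (Finset.mem_range.1 hn)
      rw [tsum_eq_sum (s := Finset.range (l + 1))]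
      · refine Finset.sum_congr rfl fun m hm => ?_
        rw [if_pos hn', if_pos (Nat.lt_succ_iff.1 (Finset.mem_range.1 hm))]
      · intro m hm
        have hm' : ¬ m ≤ l := fun h => hm (Finset.mem_range.2 (Nat.lt_succ_iff.2 h))
        simp [hm']
    · intro n hn
      have hn' : ¬ n ≤ k := fun h => hn (Finset.mem_range.2 (Nat.lt_succ_iff.2 h))
      simp [hn']
  simp_rw [h1, h2, ← ENNReal.tsum_mul_left]
  calc ∑' n, ∑' m, ∑' k, ∑' l, α k * β l * (if n ≤ k then if m ≤ l then s n m else 0 else 0)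
      = ∑' n, ∑' k, ∑' m, ∑' l, α k * β l * (if n ≤ k then if m ≤ l then s n m else 0 else 0) :=
        tsum_congr fun n => ENNReal.tsum_comm
    _ = ∑' k, ∑' n, ∑' m, ∑' l, α k * β l * (if n ≤ k then if m ≤ l then s n m else 0 else 0) :=
        ENNReal.tsum_comm
    _ = ∑' k, ∑' n, ∑' l, ∑' m, α k * β l * (if n ≤ k then if m ≤ l then s n m else 0 else 0) :=
        tsum_congr fun k => tsum_congr fun n => ENNReal.tsum_comm
    _ = _ := tsum_congr fun k => ENNReal.tsum_comm

/-- The case of the identity matrix in `tsum_tailSum_mul`. -/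
lemma tsum_corner_min (α β : ℕ → ℝ≥0∞) :
    ∑' k, ∑' l, α k * β l * ((min k l + 1 : ℕ) : ℝ≥0∞) = ∑' j, tailSum α j * tailSum β j := by
  have h := tsum_tailSum_mul α β fun n m => if n = m then 1 else 0
  have h1 : ∀ k l, ∑ n ∈ Finset.range (k + 1), ∑ m ∈ Finset.range (l + 1),
      (if n = m then (1 : ℝ≥0∞) else 0) = ((min k l + 1 : ℕ) : ℝ≥0∞) := by
    intro k l
    simp_rw [Finset.sum_ite_eq]
    rw [← Finset.sum_filter, Finset.sum_const, nsmul_one]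
    congr 1
    have : (Finset.range (k + 1)).filter (· ∈ Finset.range (l + 1)) =
        Finset.range (min k l + 1) := by
      ext x
      simp only [Finset.mem_filter, Finset.mem_range]
      omega
    rw [this, Finset.card_range]
  simp_rw [h1] at h
  rw [← h]
  refine tsum_congr fun n => ?_
  rw [tsum_eq_single n]
  · simp
  · intro m hm
    simp [hm.symm]

lemma tsum_tailSum_mul_le (α β : ℕ → ℝ≥0∞) (s : ℕ → ℕ → ℝ≥0∞) (hrow : ∀ n, ∑' m, s n m ≤ 1)
    (hcol : ∀ m, ∑' n, s n m ≤ 1) :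
    ∑' n, ∑' m, tailSum α n * tailSum β m * s n m ≤ ∑' j, tailSum α j * tailSum β j := by
  rw [tsum_tailSum_mul, ← tsum_corner_min]
  refine ENNReal.tsum_le_tsum fun k => ENNReal.tsum_le_tsum fun l => ?_
  gcongr
  have h1 : ∑ n ∈ Finset.range (k + 1), ∑ m ∈ Finset.range (l + 1), s n m ≤ (k + 1 : ℕ) := by
    refine (Finset.sum_le_sum fun n _ =>
      (ENNReal.sum_le_tsum _).trans (hrow n)).trans ?_
    simp
  have h2 : ∑ n ∈ Finset.range (k + 1), ∑ m ∈ Finset.range (l + 1), s n m ≤ (l + 1 : ℕ) := by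
    rw [Finset.sum_comm]
    refine (Finset.sum_le_sum fun m _ =>
      (ENNReal.sum_le_tsum _).trans (hcol m)).trans ?_
    simp
  rcases le_total k l with h | h
  · rwa [min_eq_left h]
  · rwa [min_eq_right h]

section Steps

variable {a b : ℕ → ℝ}

lemma step_nonneg (ha : Antitone a) (k : ℕ) : 0 ≤ a k - a (k + 1) :=
  sub_nonneg.2 (ha (Nat.le_succ k))

lemma hasSum_steps (ha : Antitone a) (hlim : Tendsto a atTop (𝓝 0)) (n : ℕ) :
    HasSum (fun k => a (k + n) - a (k + n + 1)) (a n) := by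
  rw [hasSum_iff_tendsto_nat_of_nonneg fun k => step_nonneg ha (k + n)]
  have h1 : ∀ N, ∑ k ∈ Finset.range N, (a (k + n) - a (k + n + 1)) = a n - a (N + n) := by
    intro N
    induction N with
    | zero => simp
    | succ N ih =>
      rw [Finset.sum_range_succ, ih, show N + 1 + n = N + n + 1 by ring]
      ring
  simp_rw [h1]
  simpa using ((tendsto_add_atTop_iff_nat n).2 hlim).const_sub (a n)

/-- A sequence decreasing to zero consists of the tail sums of its steps. -/
lemma ofReal_eq_tailSum (ha : Antitone a) (hlim : Tendsto a atTop (𝓝 0)) (n : ℕ) :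
    ENNReal.ofReal (a n) = tailSum (fun k => ENNReal.ofReal (a k - a (k + 1))) n := by
  have h := hasSum_steps ha hlim n
  rw [← h.tsum_eq, ENNReal.ofReal_tsum_of_nonneg (fun k => step_nonneg ha (k + n)) h.summable]
  unfold tailSum
  rw [← ENNReal.summable.sum_add_tsum_nat_add' (k := n)
    (f := fun k => if n ≤ k then ENNReal.ofReal (a k - a (k + 1)) else 0),
    Finset.sum_eq_zero, zero_add]
  · simp
  · intro k hk
    rw [if_neg (by simpa using hk)]

/-- The double sum `∑ a n * b m * s n m` of nonnegative terms. -/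
def weightedSum (a b : ℕ → ℝ) (s : ℕ → ℕ → ℝ≥0∞) : ℝ≥0∞ :=
  ∑' n, ∑' m, ENNReal.ofReal (a n) * ENNReal.ofReal (b m) * s n m

/-- Von Neumann's inequality for doubly substochastic matrices: the double sum is largest for the
identity matrix. -/
lemma weightedSum_le (ha : Antitone a) (halim : Tendsto a atTop (𝓝 0)) (hb : Antitone b)
    (hblim : Tendsto b atTop (𝓝 0)) {s : ℕ → ℕ → ℝ≥0∞} (hrow : ∀ n, ∑' m, s n m ≤ 1)
    (hcol : ∀ m, ∑' n, s n m ≤ 1) :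
    weightedSum a b s ≤ ∑' j, ENNReal.ofReal (a j) * ENNReal.ofReal (b j) := by
  unfold weightedSum
  simp_rw [ofReal_eq_tailSum ha halim, ofReal_eq_tailSum hb hblim]
  exact tsum_tailSum_mul_le _ _ _ hrow hcol

/-- If the upper left `N × N` corner does not contribute, the double sum is controlled by the
shifted sequences. -/
lemma weightedSum_le_of_corner (ha : Antitone a) (halim : Tendsto a atTop (𝓝 0))
    (hb : Antitone b) (hblim : Tendsto b atTop (𝓝 0)) {s : ℕ → ℕ → ℝ≥0∞}
    (hrow : ∀ n, ∑' m, s n m ≤ 1) (hcol : ∀ m, ∑' n, s n m ≤ 1) (N : ℕ)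
    (hN : ∀ n < N, ∀ m < N, ENNReal.ofReal (a n) * ENNReal.ofReal (b m) * s n m = 0) :
    weightedSum a b s ≤ ∑' j, ENNReal.ofReal (a (j + N)) * ENNReal.ofReal (b j) +
      ∑' j, ENNReal.ofReal (a j) * ENNReal.ofReal (b (j + N)) := by
  have hshift : ∀ {c : ℕ → ℝ}, Antitone c → Antitone fun n => c (n + N) :=
    fun hc m n hmn => hc (by omega)
  have hsub : ∀ f : ℕ → ℝ≥0∞, ∑' n, f (n + N) ≤ ∑' n, f n := fun f =>
    ENNReal.tsum_comp_le_tsum_of_injective (add_left_injective N) f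
  have h1 : weightedSum (fun n => a (n + N)) b (fun n m => s (n + N) m) ≤
      ∑' j, ENNReal.ofReal (a (j + N)) * ENNReal.ofReal (b j) :=
    weightedSum_le (hshift ha) ((tendsto_add_atTop_iff_nat N).2 halim) hb hblim
      (fun n => hrow _) fun m => (hsub fun n => s n m).trans (hcol m)
  have h2 : weightedSum a (fun n => b (n + N)) (fun n m => s n (m + N)) ≤
      ∑' j, ENNReal.ofReal (a j) * ENNReal.ofReal (b (j + N)) :=
    weightedSum_le ha halim (hshift hb) ((tendsto_add_atTop_iff_nat N).2 hblim)
      (fun n => (hsub fun m => s n m).trans (hrow n)) fun m => hcol _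
  refine le_trans ?_ (add_le_add h1 h2)
  unfold weightedSum
  rw [← ENNReal.summable.sum_add_tsum_nat_add' (k := N), add_comm]
  gcongr
  refine le_trans (Finset.sum_le_sum fun n hn => ?_) (ENNReal.sum_le_tsum (Finset.range N))
  rw [← ENNReal.summable.sum_add_tsum_nat_add' (k := N), Finset.sum_eq_zero, zero_add]
  intro m hm
  exact hN n (Finset.mem_range.1 hn) m (Finset.mem_range.1 hm)

lemma le_weightedSum_of_corner {s : ℕ → ℕ → ℝ≥0∞} (N : ℕ)
    (hN : ∀ n < N, ENNReal.ofReal (a n) * ENNReal.ofReal (b n) * s n n =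
      ENNReal.ofReal (a n) * ENNReal.ofReal (b n)) :
    ∑ j ∈ Finset.range N, ENNReal.ofReal (a j) * ENNReal.ofReal (b j) ≤ weightedSum a b s := by
  refine le_trans (Finset.sum_le_sum fun n hn => ?_) (ENNReal.sum_le_tsum (Finset.range N))
  rw [← hN n (Finset.mem_range.1 hn)]
  exact ENNReal.le_tsum n

end Steps

/-! ### The trace of a product of positive compact operators -/

section Traces

variable {H : Type*} [NormedAddCommGroup H] [InnerProductSpace ℂ H]

lemma enorm_inner_symm (x y : H) : ‖(inner ℂ x y : ℂ)‖ₑ = ‖(inner ℂ y x : ℂ)‖ₑ := by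
  rw [← ofReal_norm, ← ofReal_norm, norm_inner_symm]

lemma tsum_enorm_inner_sq_le {ι : Type*} {v : ι → H} (hv : Orthonormal ℂ v) (x : H) :
    ∑' i, ‖(inner ℂ (v i) x : ℂ)‖ₑ ^ 2 ≤ ‖x‖ₑ ^ 2 := by
  rw [ENNReal.tsum_eq_iSup_sum]
  refine iSup_le fun s => ?_
  simp_rw [← ofReal_norm, ← ENNReal.ofReal_pow (norm_nonneg _)]
  rw [← ENNReal.ofReal_sum_of_nonneg fun i _ => by positivity]
  exact ENNReal.ofReal_le_ofReal (hv.sum_inner_products_le x)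

lemma tsum_enorm_inner_mul_inner_le_one {ι : Type*} {v : ι → H} (hv : Orthonormal ℂ v) {x y : H}
    (hx : ‖x‖ ≤ 1) (hy : ‖y‖ ≤ 1) :
    ∑' i, ‖(inner ℂ x (v i) : ℂ)‖ₑ * ‖(inner ℂ (v i) y : ℂ)‖ₑ ≤ 1 := by
  have hsq : ∀ {z : H}, ‖z‖ ≤ 1 → ∑' i, ‖(inner ℂ (v i) z : ℂ)‖ₑ ^ 2 ≤ 1 := by
    intro z hz
    refine (tsum_enorm_inner_sq_le hv z).trans ?_
    rw [← ofReal_norm]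
    exact pow_le_one₀ zero_le (ENNReal.ofReal_le_one.2 hz)
  have h1 : ∀ i, 2 * (‖(inner ℂ x (v i) : ℂ)‖ₑ * ‖(inner ℂ (v i) y : ℂ)‖ₑ) ≤
      ‖(inner ℂ (v i) x : ℂ)‖ₑ ^ 2 + ‖(inner ℂ (v i) y : ℂ)‖ₑ ^ 2 := by
    intro i
    rw [enorm_inner_symm x, ← mul_assoc]
    simp only [enorm_eq_nnnorm]
    exact_mod_cast two_mul_le_add_sq (‖(inner ℂ (v i) x : ℂ)‖₊) (‖(inner ℂ (v i) y : ℂ)‖₊)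
  have h2 : 2 * ∑' i, ‖(inner ℂ x (v i) : ℂ)‖ₑ * ‖(inner ℂ (v i) y : ℂ)‖ₑ ≤ 2 * 1 := by
    rw [← ENNReal.tsum_mul_left]
    refine (ENNReal.tsum_le_tsum h1).trans ?_
    rw [ENNReal.tsum_add, mul_one]
    exact (add_le_add (hsq hx) (hsq hy)).trans_eq one_add_one_eq_two
  exact (ENNReal.mul_le_mul_iff_right (by simp) (by simp)).1 h2

/-- The orthogonal projection `x ↦ ∑ n ≤ k, ⟪e n, x⟫ • e n`. -/
def truncProj (e : ℕ → H) (k : ℕ) : H →L[ℂ] H :=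
  ∑ n ∈ Finset.range (k + 1), (innerSL ℂ (e n)).smulRight (e n)

lemma truncProj_apply (e : ℕ → H) (k : ℕ) (x : H) :
    truncProj e k x = ∑ n ∈ Finset.range (k + 1), (inner ℂ (e n) x : ℂ) • e n := by
  simp [truncProj]

lemma norm_truncProj_le {e : ℕ → H} (he : Orthonormal ℂ e) (k : ℕ) (x : H) :
    ‖truncProj e k x‖ ≤ ‖x‖ := by
  rw [← sq_le_sq₀ (norm_nonneg _) (norm_nonneg _)]
  refine le_trans (le_of_eq ?_) (he.sum_inner_products_le x (s := Finset.range (k + 1)))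
  have h := he.inner_sum (fun n => inner ℂ (e n) x) (fun n => inner ℂ (e n) x)
    (Finset.range (k + 1))
  rw [← truncProj_apply, inner_self_eq_norm_sq_to_K] at h
  have h2 : ((‖truncProj e k x‖ ^ 2 : ℝ) : ℂ) =
      ((∑ n ∈ Finset.range (k + 1), ‖(inner ℂ (e n) x : ℂ)‖ ^ 2 : ℝ) : ℂ) := by
    push_cast
    refine Eq.trans h (Finset.sum_congr rfl fun n _ => ?_)
    exact RCLike.conj_mul _
  exact_mod_cast h2

namespace HasExpansion

variable {A B : H →L[ℂ] H} {a b : ℕ → ℝ} {e f : ℕ → H}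

lemma summable_steps (h : HasExpansion A a e) : Summable fun k => a k - a (k + 1) := by
  simpa using (hasSum_steps h.antitone h.tendsto 0).summable

/-- The layer cake decomposition: a positive compact operator is a combination with nonnegative
coefficients of the projections onto the spans of its leading eigenvectors. -/
lemma hasSum_layers [CompleteSpace H] (h : HasExpansion A a e) (x : H) :
    HasSum (fun k => ((a k - a (k + 1) : ℝ) : ℂ) • truncProj e k x) (A x) := by
  have hsum : Summable fun k => ((a k - a (k + 1) : ℝ) : ℂ) • truncProj e k x := by
    refine Summable.of_norm_bounded (h.summable_steps.mul_right ‖x‖) fun k => ?_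
    rw [norm_smul, Complex.norm_real, Real.norm_of_nonneg (step_nonneg h.antitone k)]
    exact mul_le_mul_of_nonneg_left (norm_truncProj_le h.orthonormal k x)
      (step_nonneg h.antitone k)
  -- Abel summation; the boundary term is killed by `a N → 0`.
  have h1 : ∀ N, ∑ k ∈ Finset.range (N + 1), ((a k - a (k + 1) : ℝ) : ℂ) • truncProj e k x =
      ∑ n ∈ Finset.range (N + 1), (a n : ℂ) • (inner ℂ (e n) x : ℂ) • e n -
        (a (N + 1) : ℂ) • truncProj e N x := by
    intro N
    induction N with
    | zero => simp [truncProj_apply, sub_smul]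
    | succ N ih =>
      rw [Finset.sum_range_succ, ih, Finset.sum_range_succ _ (N + 1)]
      rw [truncProj_apply e (N + 1), Finset.sum_range_succ _ (N + 1), ← truncProj_apply]
      push_cast
      module
  have h2 : Tendsto (fun N => (a (N + 1) : ℂ) • truncProj e N x) atTop (𝓝 0) := by
    refine squeeze_zero_norm (a := fun N => a (N + 1) * ‖x‖) (fun N => ?_) ?_
    · rw [norm_smul, Complex.norm_real, Real.norm_of_nonneg (h.nonneg _)]
      exact mul_le_mul_of_nonneg_left (norm_truncProj_le h.orthonormal N x) (h.nonneg _)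
    · simpa using ((tendsto_add_atTop_iff_nat 1).2 h.tendsto).mul_const ‖x‖
  have h3 := ((tendsto_add_atTop_iff_nat 1).2 (h.hasSum x).tendsto_sum_nat).sub h2
  rw [sub_zero] at h3
  have h4 := (tendsto_add_atTop_iff_nat 1).2 hsum.hasSum.tendsto_sum_nat
  simp_rw [h1] at h4
  rw [← tendsto_nhds_unique h4 h3]
  exact hsum.hasSum

lemma hasSum_layers_mul [CompleteSpace H] (hA : HasExpansion A a e) (hB : HasExpansion B b f)
    (x : H) :
    HasSum (fun p : ℕ × ℕ => ((a p.1 - a (p.1 + 1) : ℝ) : ℂ) • ((b p.2 - b (p.2 + 1) : ℝ) : ℂ) •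
      truncProj e p.1 (truncProj f p.2 x)) (A (B x)) := by
  have hsum : Summable fun p : ℕ × ℕ => ((a p.1 - a (p.1 + 1) : ℝ) : ℂ) •
      ((b p.2 - b (p.2 + 1) : ℝ) : ℂ) • truncProj e p.1 (truncProj f p.2 x) := by
    refine Summable.of_norm_bounded ((hA.summable_steps.mul_of_nonneg hB.summable_steps
      (fun k => step_nonneg hA.antitone k) (fun k => step_nonneg hB.antitone k)).mul_right ‖x‖)
      fun p => ?_
    rw [norm_smul, norm_smul, Complex.norm_real, Complex.norm_real,
      Real.norm_of_nonneg (step_nonneg hA.antitone _),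
      Real.norm_of_nonneg (step_nonneg hB.antitone _), ← mul_assoc]
    exact mul_le_mul_of_nonneg_left ((norm_truncProj_le hA.orthonormal _ _).trans
      (norm_truncProj_le hB.orthonormal _ _))
      (mul_nonneg (step_nonneg hA.antitone _) (step_nonneg hB.antitone _))
  have h1 := hsum.hasSum.prod_fiberwise fun k =>
    (((hB.hasSum_layers x).mapL (truncProj e k)).const_smul ((a k - a (k + 1) : ℝ) : ℂ)).congr_fun
      fun l => by rw [map_smul]
  rw [(hA.hasSum_layers (B x)).unique h1]
  exact hsum.hasSum

end HasExpansion

/-- The squared overlaps `|⟪e n, f m⟫|²` of two families. -/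
def overlap (e f : ℕ → H) (n m : ℕ) : ℝ≥0∞ := ‖(inner ℂ (e n) (f m) : ℂ)‖ₑ ^ 2

lemma tsum_overlap_row_le {e f : ℕ → H} (he : Orthonormal ℂ e) (hf : Orthonormal ℂ f) (n : ℕ) :
    ∑' m, overlap e f n m ≤ 1 := by
  simp_rw [overlap, enorm_inner_symm (e n)]
  refine (tsum_enorm_inner_sq_le hf _).trans ?_
  rw [← ofReal_norm, he.1]
  simp

lemma tsum_overlap_col_le {e f : ℕ → H} (he : Orthonormal ℂ e) (hf : Orthonormal ℂ f) (m : ℕ) :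
    ∑' n, overlap e f n m ≤ 1 := by
  refine (tsum_enorm_inner_sq_le he _).trans ?_
  rw [← ofReal_norm, hf.1]
  simp

section Corner

variable {e f : ℕ → H}

lemma inner_truncProj_truncProj (k l : ℕ) (x : H) :
    (inner ℂ x (truncProj e k (truncProj f l x)) : ℂ) =
      ∑ n ∈ Finset.range (k + 1), ∑ m ∈ Finset.range (l + 1),
        (inner ℂ (e n) (f m) : ℂ) * ((inner ℂ (f m) x : ℂ) * (inner ℂ x (e n) : ℂ)) := by
  simp only [truncProj_apply, inner_sum, inner_smul_right, Finset.sum_mul]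
  refine Finset.sum_congr rfl fun n _ => Finset.sum_congr rfl fun m _ => ?_
  ring

lemma hasSum_inner_truncProj {ι : Type*} (v : HilbertBasis ι ℂ H) (k l : ℕ) :
    HasSum (fun i => (inner ℂ (v i) (truncProj e k (truncProj f l (v i))) : ℂ))
      ((∑ n ∈ Finset.range (k + 1), ∑ m ∈ Finset.range (l + 1),
        ‖(inner ℂ (e n) (f m) : ℂ)‖ ^ 2 : ℝ) : ℂ) := by
  simp_rw [inner_truncProj_truncProj]
  push_cast
  refine hasSum_sum fun n _ => hasSum_sum fun m _ => ?_
  have h := (v.hasSum_inner_mul_inner (f m) (e n)).mul_left (inner ℂ (e n) (f m) : ℂ)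
  have h2 : (inner ℂ (e n) (f m) : ℂ) * inner ℂ (f m) (e n) =
      (‖(inner ℂ (e n) (f m) : ℂ)‖ : ℂ) ^ 2 := by
    rw [← inner_conj_symm (f m) (e n)]
    exact RCLike.mul_conj _
  rwa [h2] at h

/-- The product of two projections of ranks `k + 1` and `l + 1` has trace norm at most the smaller
of the two ranks. -/
lemma tsum_enorm_inner_truncProj_le (he : Orthonormal ℂ e) (hf : Orthonormal ℂ f) {ι : Type*}
    {v : ι → H} (hv : Orthonormal ℂ v) (k l : ℕ) :
    ∑' i, ‖(inner ℂ (v i) (truncProj e k (truncProj f l (v i))) : ℂ)‖ₑ ≤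
      ((min k l + 1 : ℕ) : ℝ≥0∞) := by
  have hsum : ∀ (N : ℕ) (g h : ℕ → H), (∀ n, ‖g n‖ ≤ 1) → (∀ n, ‖h n‖ ≤ 1) →
      (∀ x, (inner ℂ x (truncProj e k (truncProj f l x)) : ℂ) =
        ∑ n ∈ Finset.range (N + 1), (inner ℂ (g n) x : ℂ) * (inner ℂ x (h n) : ℂ)) →
      ∑' i, ‖(inner ℂ (v i) (truncProj e k (truncProj f l (v i))) : ℂ)‖ₑ ≤
        ((N + 1 : ℕ) : ℝ≥0∞) := by
    intro N g h hg hh heq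
    calc ∑' i, ‖(inner ℂ (v i) (truncProj e k (truncProj f l (v i))) : ℂ)‖ₑ
        ≤ ∑' i, ∑ n ∈ Finset.range (N + 1),
            ‖(inner ℂ (g n) (v i) : ℂ)‖ₑ * ‖(inner ℂ (v i) (h n) : ℂ)‖ₑ := by
          refine ENNReal.tsum_le_tsum fun i => ?_
          rw [heq]
          refine (enorm_sum_le _ _).trans (le_of_eq ?_)
          simp_rw [enorm_mul]
      _ = ∑ n ∈ Finset.range (N + 1), ∑' i,
            ‖(inner ℂ (g n) (v i) : ℂ)‖ₑ * ‖(inner ℂ (v i) (h n) : ℂ)‖ₑ :=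
          Summable.tsum_finsetSum fun _ _ => ENNReal.summable
      _ ≤ ∑ n ∈ Finset.range (N + 1), 1 := Finset.sum_le_sum fun n _ =>
          tsum_enorm_inner_mul_inner_le_one hv (hg n) (hh n)
      _ = _ := by simp
  rcases le_total k l with hkl | hkl
  · rw [min_eq_left hkl]
    refine hsum k (fun n => truncProj f l (e n)) e (fun n => ?_) (fun n => (he.1 n).le) fun x => ?_
    · exact (norm_truncProj_le hf l _).trans (he.1 n).le
    · rw [inner_truncProj_truncProj]
      refine Finset.sum_congr rfl fun n _ => ?_
      rw [truncProj_apply, sum_inner, Finset.sum_mul]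
      refine Finset.sum_congr rfl fun m _ => ?_
      rw [inner_smul_left, inner_conj_symm]
      ring
  · rw [min_eq_right hkl]
    refine hsum l f (fun m => truncProj e k (f m)) (fun n => (hf.1 n).le) (fun m => ?_) fun x => ?_
    · exact (norm_truncProj_le he k _).trans (hf.1 m).le
    · rw [inner_truncProj_truncProj, Finset.sum_comm]
      refine Finset.sum_congr rfl fun m _ => ?_
      rw [truncProj_apply, inner_sum, Finset.mul_sum]
      refine Finset.sum_congr rfl fun n _ => ?_
      rw [inner_smul_right]
      ring

end Corner

namespace HasExpansion

variable {A B : H →L[ℂ] H} {a b : ℕ → ℝ} {e f : ℕ → H}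

lemma weightedSum_le (hA : HasExpansion A a e) (hB : HasExpansion B b f) :
    weightedSum a b (overlap e f) ≤ ∑' j, ENNReal.ofReal (a j) * ENNReal.ofReal (b j) :=
  SchattenVonNeumann.weightedSum_le hA.antitone hA.tendsto hB.antitone hB.tendsto
    (tsum_overlap_row_le hA.orthonormal hB.orthonormal)
    (tsum_overlap_col_le hA.orthonormal hB.orthonormal)

/-- The trace of `A B` for positive compact operators: the layer cake decompositions of `A` and `B`
turn the series into an absolutely convergent triple series, whose sum does not depend on the
orthonormal basis. -/
lemma hasSum_trace [CompleteSpace H] (hA : HasExpansion A a e) (hB : HasExpansion B b f)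
    (hfin : ∑' j, ENNReal.ofReal (a j) * ENNReal.ofReal (b j) ≠ ∞) {ι : Type*}
    (v : HilbertBasis ι ℂ H) :
    HasSum (fun i => (inner ℂ (v i) (A (B (v i))) : ℂ))
      ((weightedSum a b (overlap e f)).toReal : ℂ) := by
  set α : ℕ → ℝ := fun k => a k - a (k + 1) with hα
  set β : ℕ → ℝ := fun k => b k - b (k + 1) with hβ
  have hα0 : ∀ k, 0 ≤ α k := step_nonneg hA.antitone
  have hβ0 : ∀ k, 0 ≤ β k := step_nonneg hB.antitone
  let G : ι × ℕ × ℕ → ℂ := fun q => (α q.2.1 : ℂ) * ((β q.2.2 : ℂ) *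
    inner ℂ (v q.1) (truncProj e q.2.1 (truncProj f q.2.2 (v q.1))))
  have hG : Summable G := by
    have hne : ∑' q, ‖G q‖ₑ ≠ ∞ := by
      refine ne_top_of_le_ne_top hfin ?_
      simp_rw [ofReal_eq_tailSum hA.antitone hA.tendsto, ofReal_eq_tailSum hB.antitone hB.tendsto]
      rw [← tsum_corner_min, ENNReal.tsum_prod', ENNReal.tsum_comm, ENNReal.tsum_prod']
      refine ENNReal.tsum_le_tsum fun k => ENNReal.tsum_le_tsum fun l => ?_
      simp only [G, enorm_mul]
      rw [ENNReal.tsum_mul_left, ENNReal.tsum_mul_left, ← mul_assoc]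
      have h1 : ‖(α k : ℂ)‖ₑ = ENNReal.ofReal (a k - a (k + 1)) := by
        rw [← ofReal_norm, Complex.norm_real, Real.norm_of_nonneg (hα0 k)]
      have h2 : ‖(β l : ℂ)‖ₑ = ENNReal.ofReal (b l - b (l + 1)) := by
        rw [← ofReal_norm, Complex.norm_real, Real.norm_of_nonneg (hβ0 l)]
      rw [h1, h2]
      gcongr
      exact tsum_enorm_inner_truncProj_le hA.orthonormal hB.orthonormal v.orthonormal k l
    refine Summable.of_norm ?_
    have := ENNReal.summable_toReal hne
    simpa using this
  -- Summing over the layers first gives the trace series.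
  have h1 : HasSum (fun i => (inner ℂ (v i) (A (B (v i))) : ℂ)) (∑' q, G q) := by
    refine hG.hasSum.prod_fiberwise fun i => ?_
    have h := (hA.hasSum_layers_mul hB (v i)).mapL (innerSL ℂ (v i))
    simpa only [innerSL_apply_apply, inner_smul_right] using h
  -- Summing over the basis first gives the weighted sum of overlaps.
  have h2 : HasSum (fun p : ℕ × ℕ => ((α p.1 * (β p.2 * ∑ n ∈ Finset.range (p.1 + 1),
      ∑ m ∈ Finset.range (p.2 + 1), ‖(inner ℂ (e n) (f m) : ℂ)‖ ^ 2) : ℝ) : ℂ)) (∑' q, G q) := by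
    have h := ((Equiv.prodComm (ℕ × ℕ) ι).hasSum_iff (f := G)).2 hG.hasSum
    refine h.prod_fiberwise fun p => ?_
    have h3 := ((hasSum_inner_truncProj (e := e) (f := f) v p.1 p.2).mul_left
      (β p.2 : ℂ)).mul_left (α p.1 : ℂ)
    rw [← Complex.ofReal_mul, ← Complex.ofReal_mul] at h3
    exact h3
  have h3 : weightedSum a b (overlap e f) = ∑' p : ℕ × ℕ, ENNReal.ofReal (α p.1 * (β p.2 *
      ∑ n ∈ Finset.range (p.1 + 1), ∑ m ∈ Finset.range (p.2 + 1),
        ‖(inner ℂ (e n) (f m) : ℂ)‖ ^ 2)) := by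
    unfold weightedSum
    simp_rw [ofReal_eq_tailSum hA.antitone hA.tendsto, ofReal_eq_tailSum hB.antitone hB.tendsto]
    rw [tsum_tailSum_mul, ENNReal.tsum_prod']
    refine tsum_congr fun k => tsum_congr fun l => ?_
    rw [ENNReal.ofReal_mul (hα0 k), ENNReal.ofReal_mul (hβ0 l), mul_assoc,
      ENNReal.ofReal_sum_of_nonneg fun _ _ => by positivity]
    congr 2
    refine Finset.sum_congr rfl fun n _ => ?_
    rw [ENNReal.ofReal_sum_of_nonneg fun _ _ => by positivity]
    refine Finset.sum_congr rfl fun m _ => ?_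
    rw [overlap, ← ofReal_norm, ENNReal.ofReal_pow (norm_nonneg _)]
  have h4 : ((weightedSum a b (overlap e f)).toReal : ℂ) = ∑' q, G q := by
    rw [← h2.tsum_eq, ← Complex.ofReal_tsum, h3, ENNReal.tsum_toReal_eq fun _ =>
      ENNReal.ofReal_ne_top]
    congr 1
    refine tsum_congr fun p => ENNReal.toReal_ofReal ?_
    have := hα0 p.1
    have := hβ0 p.2
    positivity
  rw [h4]
  exact h1

/-- Conjugation by a unitary transports eigenvalue expansions. -/
lemma conj [CompleteSpace H] (h : HasExpansion A a e) (U : unitary (H →L[ℂ] H)) :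
    HasExpansion (star (U : H →L[ℂ] H) * A * (U : H →L[ℂ] H)) a
      (fun n => star (U : H →L[ℂ] H) (e n)) where
  orthonormal := by
    have hU : (U : H →L[ℂ] H) * star (U : H →L[ℂ] H) = 1 := Unitary.coe_mul_star_self U
    have hin : ∀ x y : H, inner ℂ (star (U : H →L[ℂ] H) x) (star (U : H →L[ℂ] H) y) =
        inner ℂ x y := by
      intro x y
      rw [ContinuousLinearMap.star_eq_adjoint, ContinuousLinearMap.adjoint_inner_left,
        ← ContinuousLinearMap.star_eq_adjoint, ← mul_apply_eq_comp, hU]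
      rfl
    have h0 := h.orthonormal
    rw [orthonormal_iff_ite] at h0 ⊢
    intro i j
    rw [hin]
    exact h0 i j
  antitone := h.antitone
  tendsto := h.tendsto
  hasSum x := by
    have h1 := (h.hasSum ((U : H →L[ℂ] H) x)).mapL (star (U : H →L[ℂ] H))
    convert! h1 using 1
    ext n
    rw [map_smul, map_smul, ContinuousLinearMap.star_eq_adjoint,
      ContinuousLinearMap.adjoint_inner_left]

end HasExpansion

end Traces

/-! ### Unitaries with prescribed values on a finite orthonormal family -/

section Parts

variable {H : Type*} [NormedAddCommGroup H] [InnerProductSpace ℂ H] [CompleteSpace H]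

/-- An orthonormal finite family can be moved to any other one by a unitary. -/
lemma exists_unitary_apply_eq {ι : Type*} [Finite ι] {g h : ι → H} (hg : Orthonormal ℂ g)
    (hh : Orthonormal ℂ h) : ∃ U : unitary (H →L[ℂ] H), ∀ i, (U : H →L[ℂ] H) (g i) = h i := by
  have := Fintype.ofFinite ι
  -- The unitary acts on the finite-dimensional space `V` spanned by both families, and trivially on
  -- its orthogonal complement.
  let V : Submodule ℂ H := Submodule.span ℂ (Set.range g ∪ Set.range h)
  have hV : FiniteDimensional ℂ V :=
    FiniteDimensional.span_of_finite ℂ ((Set.finite_range g).union (Set.finite_range h))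
  let g' : ι → V := fun i => ⟨g i, Submodule.subset_span (Or.inl ⟨i, rfl⟩)⟩
  let h' : ι → V := fun i => ⟨h i, Submodule.subset_span (Or.inr ⟨i, rfl⟩)⟩
  have hg' : Orthonormal ℂ g' := (V.subtypeₗᵢ.orthonormal_comp_iff).1 hg
  have hh' : Orthonormal ℂ h' := (V.subtypeₗᵢ.orthonormal_comp_iff).1 hh
  have hcard : Fintype.card ι ≤ Module.finrank ℂ V :=
    hg'.linearIndependent.fintype_card_le_finrank
  let κ := ι ⊕ Fin (Module.finrank ℂ V - Fintype.card ι)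
  have hext : ∀ k : ι → V, Orthonormal ℂ k →
      ∃ b : OrthonormalBasis κ ℂ V, ∀ i, b (Sum.inl i) = k i := by
    intro k hk
    obtain ⟨b, hb⟩ := Orthonormal.exists_orthonormalBasis_extension_of_card_eq (𝕜 := ℂ) (ι := κ)
      (E := V) (by simp only [κ, Fintype.card_sum, Fintype.card_fin]; omega)
      (v := Sum.elim k 0) (s := Set.range Sum.inl) (by
        have := hk.comp (Equiv.ofInjective (Sum.inl : ι → κ) Sum.inl_injective).symm
          (Equiv.injective _)
        have heq : (Set.range (Sum.inl : ι → κ)).domRestrict (Sum.elim k 0) =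
            k ∘ (Equiv.ofInjective (Sum.inl : ι → κ) Sum.inl_injective).symm := by
          funext ⟨_, i, rfl⟩
          simp
        rw [heq]
        exact this)
    exact ⟨b, fun i => hb _ ⟨i, rfl⟩⟩
  obtain ⟨b₁, hb₁⟩ := hext g' hg'
  obtain ⟨b₂, hb₂⟩ := hext h' hh'
  let Φ : H ≃ₗᵢ[ℂ] H := V.orthogonalDecomposition.trans
    ((LinearIsometryEquiv.withLpProdCongr 2 (b₁.equiv b₂ (Equiv.refl κ))
      (LinearIsometryEquiv.refl ℂ Vᗮ)).trans V.orthogonalDecomposition.symm)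
  refine ⟨Unitary.linearIsometryEquiv.symm Φ, fun i => ?_⟩
  have h1 : V.orthogonalDecomposition (g i) = WithLp.toLp 2 (g' i, 0) := by
    rw [LinearIsometryEquiv.eq_symm_apply .. |>.symm]
    simp [g']
  have h2 : V.orthogonalDecomposition.symm (WithLp.toLp 2 (h' i, 0)) = h i := by
    simp [h']
  change Φ (g i) = h i
  simp only [Φ, LinearIsometryEquiv.trans_apply]
  rw [h1, ← h2]
  congr 1
  have h3 : b₁.equiv b₂ (Equiv.refl κ) (g' i) = h' i := by
    rw [← hb₁, ← hb₂, OrthonormalBasis.equiv_apply_basis]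
    rfl
  rw [← h3]
  simp

/-! ### Positive and negative parts of compact operators -/

/-- A positive operator is compact if its square is; this is how compactness passes from `C` to its
positive part, whose square is `C⁺ * C`. -/
lemma isCompactOperator_of_mul_self {A : H →L[ℂ] H} (hA : A.IsPositive)
    (h : IsCompactOperator (A * A)) : IsCompactOperator A := by
  refine (isCompactOperator_iff_isCompact_closure_image_closedBall (A : H →ₗ[ℂ] H) one_pos).2 ?_
  refine isCompact_iff_totallyBounded_isComplete.2 ⟨?_, isClosed_closure.isComplete⟩
  refine TotallyBounded.closure ?_
  have hc := h.isCompact_closure_image_closedBall (f := ((A * A : H →L[ℂ] H) : H →ₗ[ℂ] H)) 1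
  rw [Metric.totallyBounded_iff]
  intro ε hε
  -- Cover by preimages of small sets under `A * A`, using `‖A x‖² ≤ ‖A (A x)‖ ‖x‖`.
  have htb := (hc.totallyBounded.subset subset_closure)
  rw [Metric.totallyBounded_iff] at htb
  obtain ⟨t, ht, hcov⟩ := htb (ε ^ 2 / 4 / 2) (by positivity)
  let S : H → Set H := fun y => {x | x ∈ Metric.closedBall (0 : H) 1 ∧
    A (A x) ∈ Metric.ball y (ε ^ 2 / 4 / 2)}
  classical
  let c : H → H := fun y => if hy : (S y).Nonempty then hy.some else 0
  refine ⟨(fun y => A (c y)) '' t, ht.image _, ?_⟩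
  rintro _ ⟨x, hx, rfl⟩
  obtain ⟨y, hy, hxy⟩ := Set.mem_iUnion₂.1 (hcov ⟨x, hx, rfl⟩)
  have hne : (S y).Nonempty := ⟨x, hx, hxy⟩
  have hcS : c y ∈ S y := by
    simp only [c, dif_pos hne]
    exact hne.some_mem
  refine Set.mem_iUnion₂.2 ⟨A (c y), ⟨y, hy, rfl⟩, ?_⟩
  have h1 : ‖A (A (x - c y))‖ < ε ^ 2 / 4 := by
    have h11 : dist (A (A x)) y < ε ^ 2 / 4 / 2 := hxy
    have h12 : dist (A (A (c y))) y < ε ^ 2 / 4 / 2 := hcS.2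
    have h13 := dist_triangle_right (A (A x)) (A (A (c y))) y
    rw [dist_eq_norm, ← map_sub, ← map_sub] at h13
    linarith
  have h2 : ‖x - c y‖ ≤ 2 := by
    have h21 : ‖x‖ ≤ 1 := by simpa using hx
    have h22 : ‖c y‖ ≤ 1 := by simpa using hcS.1
    exact (norm_sub_le _ _).trans (by linarith)
  have h3 : ‖A (x - c y)‖ ^ 2 ≤ ‖A (A (x - c y))‖ * ‖x - c y‖ := by
    have h31 : (inner ℂ (A (A (x - c y))) (x - c y) : ℂ) = ((‖A (x - c y)‖ ^ 2 : ℝ) : ℂ) := by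
      rw [show (inner ℂ (A (A (x - c y))) (x - c y) : ℂ) = inner ℂ (A (x - c y)) (A (x - c y)) from
        hA.isSymmetric _ _, inner_self_eq_norm_sq_to_K]
      simp
    have h32 := norm_inner_le_norm (𝕜 := ℂ) (A (A (x - c y))) (x - c y)
    rw [h31, Complex.norm_real, Real.norm_of_nonneg (by positivity)] at h32
    exact h32
  have h4 : dist (A x) (A (c y)) < ε := by
    rw [dist_eq_norm, ← map_sub]
    refine lt_of_pow_lt_pow_left₀ 2 hε.le ?_
    nlinarith [norm_nonneg (A (A (x - c y)))]
  exact h4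

section PosPart

variable {C : H →L[ℂ] H}

lemma isPositive_posPart (C : H →L[ℂ] H) : C⁺.IsPositive :=
  (ContinuousLinearMap.nonneg_iff_isPositive _).1 (CFC.posPart_nonneg C)

lemma isPositive_negPart (C : H →L[ℂ] H) : C⁻.IsPositive :=
  (ContinuousLinearMap.nonneg_iff_isPositive _).1 (CFC.negPart_nonneg C)

lemma isCompactOperator_posPart (hc : IsCompactOperator C) (hC : IsSelfAdjoint C) :
    IsCompactOperator (C⁺ : H →L[ℂ] H) := by
  refine isCompactOperator_of_mul_self (isPositive_posPart C) ?_
  have h : C⁺ * C⁺ = C⁺ * C := by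
    have h1 := congrArg (C⁺ * ·) (CFC.posPart_sub_negPart C hC)
    simpa only [mul_sub, CFC.posPart_mul_negPart, sub_zero] using h1
  rw [h]
  exact hc.clm_comp C⁺

lemma isCompactOperator_negPart (hc : IsCompactOperator C) (hC : IsSelfAdjoint C) :
    IsCompactOperator (C⁻ : H →L[ℂ] H) := by
  rw [← CFC.posPart_neg]
  exact isCompactOperator_posPart hc.neg hC.neg

lemma isCompactOperator_star_mul_self (hc : IsCompactOperator C) :
    IsCompactOperator (star C * C) := hc.clm_comp (star C)

lemma isPositive_star_mul_self (C : H →L[ℂ] H) : (star C * C).IsPositive :=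
  (ContinuousLinearMap.nonneg_iff_isPositive _).1 (star_mul_self_nonneg C)

lemma antitone_eigDown {A : H →L[ℂ] H} (hc : IsCompactOperator A) (hA : A.IsPositive) :
    Antitone (eigDown A) := by
  obtain ⟨I, b, l, h⟩ := exists_eigenFamily hc hA
  rw [h.eigDown_eq]
  exact antitone_decRearr h.finite

lemma eigDown_posPart_le_singularNumber (hc : IsCompactOperator C) (hC : IsSelfAdjoint C) (n : ℕ) :
    eigDown C⁺ n ≤ singularNumber C n := by
  rcases (eigDown_nonneg C⁺ n).eq_or_lt with h0 | hpos
  · rw [← h0]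
    exact Real.sqrt_nonneg _
  set μ := eigDown C⁺ n with hμ
  have h1 := (le_eigDown_iff (isCompactOperator_posPart hc hC) (isPositive_posPart C) hpos n).1
    hμ.le
  have hc' := isCompactOperator_star_mul_self hc
  have hp' := isPositive_star_mul_self C
  have hfd := finiteDimensional_eigSpan hc' hp' (pow_pos hpos 2)
  -- Eigenvectors of `C⁺` are eigenvectors of `C† C` for the squared eigenvalue.
  have hle : eigSpan C⁺ μ ≤ eigSpan (star C * C) (μ ^ 2) := by
    refine iSup₂_le fun ν (hν : μ ≤ ν) x hx => ?_
    refine Submodule.mem_iSup_of_mem (ν ^ 2)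
      (Submodule.mem_iSup_of_mem (show μ ^ 2 ≤ ν ^ 2 by gcongr) ?_)
    have hx' : C⁺ x = (ν : ℂ) • x := Module.End.mem_eigenspace_iff.1 hx
    have hν0 : (ν : ℂ) ≠ 0 := by exact_mod_cast (hpos.trans_le hν).ne'
    have hneg : C⁻ x = 0 := by
      have h2 : C⁻ (C⁺ x) = 0 := by
        rw [← mul_apply_eq_comp, CFC.negPart_mul_posPart]
        rfl
      rw [hx', map_smul] at h2
      exact (smul_eq_zero.1 h2).resolve_left hν0
    have hCx : C x = (ν : ℂ) • x := by
      rw [← CFC.posPart_sub_negPart C hC, sub_apply, hneg, hx', sub_zero]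
    refine Module.End.mem_eigenspace_iff.2 ?_
    change (star C * C) x = _
    rw [hC.star_eq, mul_apply_eq_comp, hCx, map_smul, hCx, smul_smul]
    push_cast
    rw [pow_two]
  have h2 := (le_eigDown_iff hc' hp' (pow_pos hpos 2) n).2
    (h1.trans_le (Submodule.finrank_mono hle))
  exact Real.le_sqrt_of_sq_le h2

lemma singularNumber_neg (C : H →L[ℂ] H) : singularNumber (-C) = singularNumber C := by
  ext n
  simp [singularNumber]

lemma eigDown_negPart_le_singularNumber (hc : IsCompactOperator C) (hC : IsSelfAdjoint C) (n : ℕ) :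
    eigDown C⁻ n ≤ singularNumber C n := by
  rw [← CFC.posPart_neg, ← singularNumber_neg]
  exact eigDown_posPart_le_singularNumber hc.neg hC.neg n

end PosPart

/-! ### Hölder's inequality for singular numbers -/

lemma singularNumber_nonneg (C : H →L[ℂ] H) (n : ℕ) : 0 ≤ singularNumber C n := Real.sqrt_nonneg _

lemma singularNumber_le_singularNumber_zero {C : H →L[ℂ] H} (hc : IsCompactOperator C) (n : ℕ) :
    singularNumber C n ≤ singularNumber C 0 :=
  Real.sqrt_le_sqrt (antitone_eigDown (isCompactOperator_star_mul_self hc)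
    (isPositive_star_mul_self C) (Nat.zero_le n))

lemma summable_singularNumber_mul {p q : ℝ≥0∞} (hpq : p⁻¹ + q⁻¹ = 1) {C T : H →L[ℂ] H}
    (hC : IsSchatten p C) (hT : IsSchatten q T) :
    Summable fun n => singularNumber C n * singularNumber T n := by
  by_cases hp : p = ∞
  · subst hp
    have hq : q = 1 := by simpa using hpq
    subst hq
    have h1 : Summable fun n => singularNumber T n := by simpa using hT.2
    refine Summable.of_nonneg_of_le
      (fun n => mul_nonneg (singularNumber_nonneg C n) (singularNumber_nonneg T n)) (fun n => ?_)
      (h1.mul_left (singularNumber C 0))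
    exact mul_le_mul_of_nonneg_right (singularNumber_le_singularNumber_zero hC.1 n)
      (singularNumber_nonneg T n)
  by_cases hq : q = ∞
  · subst hq
    have hp : p = 1 := by simpa using hpq
    subst hp
    have h1 : Summable fun n => singularNumber C n := by simpa using hC.2
    refine Summable.of_nonneg_of_le
      (fun n => mul_nonneg (singularNumber_nonneg C n) (singularNumber_nonneg T n)) (fun n => ?_)
      (h1.mul_right (singularNumber T 0))
    exact mul_le_mul_of_nonneg_left (singularNumber_le_singularNumber_zero hT.1 n)
      (singularNumber_nonneg C n)
  have hconj : ENNReal.HolderConjugate p q := ⟨by simpa using hpq⟩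
  exact Real.summable_mul_of_Lp_Lq_of_nonneg (ENNReal.HolderConjugate.toReal_of_ne_top hp hq)
    (singularNumber_nonneg C) (singularNumber_nonneg T) (hC.2 hp) (hT.2 hq)

end Parts

/-! ### Optimizing over unitaries -/

section Optimization

section Sequences

variable {a b : ℕ → ℝ}

lemma tsum_ofReal_mul (ha : ∀ n, 0 ≤ a n) (hb : ∀ n, 0 ≤ b n)
    (hs : Summable fun n => a n * b n) :
    ∑' n, ENNReal.ofReal (a n) * ENNReal.ofReal (b n) = ENNReal.ofReal (∑' n, a n * b n) := by
  rw [ENNReal.ofReal_tsum_of_nonneg (fun n => mul_nonneg (ha n) (hb n)) hs]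
  exact tsum_congr fun n => (ENNReal.ofReal_mul (ha n)).symm

lemma shift_mul_le (ha : Antitone a) (hb : ∀ n, 0 ≤ b n) (N n : ℕ) :
    a (n + N) * b n ≤ a n * b n :=
  mul_le_mul_of_nonneg_right (ha (Nat.le_add_right n N)) (hb n)

lemma summable_shift_mul (ha : Antitone a) (ha0 : ∀ n, 0 ≤ a n) (hb : ∀ n, 0 ≤ b n)
    (hs : Summable fun n => a n * b n) (N : ℕ) : Summable fun n => a (n + N) * b n :=
  Summable.of_nonneg_of_le (fun n => mul_nonneg (ha0 _) (hb n)) (shift_mul_le ha hb N) hs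

lemma tendsto_tsum_shift_mul (ha : Antitone a) (hlim : Tendsto a atTop (𝓝 0))
    (hb : ∀ n, 0 ≤ b n) (hs : Summable fun n => a n * b n) :
    Tendsto (fun N => ∑' n, a (n + N) * b n) atTop (𝓝 0) := by
  have ha0 : ∀ n, 0 ≤ a n := fun n => ha.le_of_tendsto hlim n
  have h := tendsto_tsum_of_dominated_convergence (𝓕 := atTop)
    (f := fun N n => a (n + N) * b n) (g := fun _ => (0 : ℝ)) hs (fun n => ?_)
    (Eventually.of_forall fun N n => ?_)
  · simpa using h
  · have h1 := ((tendsto_add_atTop_iff_nat n).2 hlim).mul_const (b n)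
    simpa [add_comm] using h1
  · rw [Real.norm_of_nonneg (mul_nonneg (ha0 _) (hb n))]
    exact shift_mul_le ha hb N n

end Sequences

variable {H : Type*} [NormedAddCommGroup H] [InnerProductSpace ℂ H]

/-- Eigenvalue expansions of the positive part `P` and the negative part `N` of a self-adjoint
compact operator, along sequences of vectors that are mutually orthogonal wherever both
coefficients are nonzero. -/
structure SignedExpansion (P N : H →L[ℂ] H) (a b : ℕ → ℝ) (e f : ℕ → H) : Prop where
  pos : HasExpansion P a e
  neg : HasExpansion N b f
  orthogonal : ∀ i j, a i ≠ 0 → b j ≠ 0 → inner ℂ (e i) (f j) = (0 : ℂ)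

/-- The trace of `(P - N) * (P' - N')` in terms of the eigenvalue expansions of the four
operators. -/
def traceValue (a b a' b' : ℕ → ℝ) (e f e' f' : ℕ → H) : ℝ :=
  (weightedSum a a' (overlap e e')).toReal + (weightedSum b b' (overlap f f')).toReal -
    (weightedSum a b' (overlap e f')).toReal - (weightedSum b a' (overlap f e')).toReal

lemma traceValue_swap (a b a' b' : ℕ → ℝ) (e f e' f' : ℕ → H) :
    traceValue a b b' a' e f f' e' = -traceValue a b a' b' e f e' f' := by
  unfold traceValue
  ring

namespace HasExpansion

variable {A B : H →L[ℂ] H} {a b : ℕ → ℝ} {e f : ℕ → H}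

lemma tsum_ofReal_ne_top (hA : HasExpansion A a e) (hB : HasExpansion B b f)
    (hs : Summable fun n => a n * b n) :
    ∑' j, ENNReal.ofReal (a j) * ENNReal.ofReal (b j) ≠ ∞ := by
  rw [tsum_ofReal_mul hA.nonneg hB.nonneg hs]
  exact ENNReal.ofReal_ne_top

lemma toReal_weightedSum_le (hA : HasExpansion A a e) (hB : HasExpansion B b f)
    (hs : Summable fun n => a n * b n) :
    (weightedSum a b (overlap e f)).toReal ≤ ∑' n, a n * b n := by
  have h := hA.weightedSum_le hB
  rw [tsum_ofReal_mul hA.nonneg hB.nonneg hs] at h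
  exact ENNReal.toReal_le_of_le_ofReal
    (tsum_nonneg fun n => mul_nonneg (hA.nonneg n) (hB.nonneg n)) h

lemma toReal_weightedSum_le_of_corner (hA : HasExpansion A a e) (hB : HasExpansion B b f)
    (hs : Summable fun n => a n * b n) (N : ℕ)
    (hN : ∀ n < N, ∀ m < N, a n ≠ 0 → b m ≠ 0 → inner ℂ (e n) (f m) = (0 : ℂ)) :
    (weightedSum a b (overlap e f)).toReal ≤
      ∑' j, a (j + N) * b j + ∑' j, b (j + N) * a j := by
  have hs' : Summable fun n => b n * a n := by simpa only [mul_comm] using hs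
  have h := weightedSum_le_of_corner hA.antitone hA.tendsto hB.antitone hB.tendsto
    (tsum_overlap_row_le hA.orthonormal hB.orthonormal)
    (tsum_overlap_col_le hA.orthonormal hB.orthonormal) N (fun n hn m hm => by
      by_cases h1 : a n = 0
      · simp [h1]
      by_cases h2 : b m = 0
      · simp [h2]
      simp [overlap, hN n hn m hm h1 h2])
  have h3 : ∑' j, ENNReal.ofReal (a j) * ENNReal.ofReal (b (j + N)) =
      ∑' j, ENNReal.ofReal (b (j + N)) * ENNReal.ofReal (a j) :=
    tsum_congr fun j => mul_comm _ _
  have h4 : (0 : ℝ) ≤ ∑' j, a (j + N) * b j :=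
    tsum_nonneg fun n => mul_nonneg (hA.nonneg _) (hB.nonneg n)
  have h5 : (0 : ℝ) ≤ ∑' j, b (j + N) * a j :=
    tsum_nonneg fun n => mul_nonneg (hB.nonneg _) (hA.nonneg n)
  rw [h3, tsum_ofReal_mul (fun n => hA.nonneg (n + N)) hB.nonneg
      (summable_shift_mul hA.antitone hA.nonneg hB.nonneg hs N),
    tsum_ofReal_mul (fun n => hB.nonneg (n + N)) hA.nonneg
      (summable_shift_mul hB.antitone hB.nonneg hA.nonneg hs' N),
    ← ENNReal.ofReal_add h4 h5] at h
  exact ENNReal.toReal_le_of_le_ofReal (add_nonneg h4 h5) h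

lemma le_toReal_weightedSum_of_corner (hA : HasExpansion A a e) (hB : HasExpansion B b f)
    (hs : Summable fun n => a n * b n) (N : ℕ)
    (hN : ∀ n < N, a n ≠ 0 → b n ≠ 0 → inner ℂ (e n) (f n) = (1 : ℂ)) :
    ∑ j ∈ Finset.range N, a j * b j ≤ (weightedSum a b (overlap e f)).toReal := by
  have h := le_weightedSum_of_corner (a := a) (b := b) (s := overlap e f) N (fun n hn => by
      by_cases h1 : a n = 0
      · simp [h1]
      by_cases h2 : b n = 0
      · simp [h2]
      simp [overlap, hN n hn h1 h2])
  have hne : weightedSum a b (overlap e f) ≠ ∞ :=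
    ne_top_of_le_ne_top (hA.tsum_ofReal_ne_top hB hs) (hA.weightedSum_le hB)
  rw [← ENNReal.ofReal_le_iff_le_toReal hne,
    ENNReal.ofReal_sum_of_nonneg fun n _ => mul_nonneg (hA.nonneg n) (hB.nonneg n)]
  refine le_trans (le_of_eq ?_) h
  exact Finset.sum_congr rfl fun n _ => ENNReal.ofReal_mul (hA.nonneg n)

end HasExpansion

namespace SignedExpansion

variable {P N P' N' : H →L[ℂ] H} {a b a' b' : ℕ → ℝ} {e f e' f' : ℕ → H}

lemma swap (h : SignedExpansion P N a b e f) : SignedExpansion N P b a f e where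
  pos := h.neg
  neg := h.pos
  orthogonal i j hi hj := inner_eq_zero_symm.1 (h.orthogonal j i hj hi)

lemma traceValue_le (h : SignedExpansion P N a b e f) (h' : SignedExpansion P' N' a' b' e' f')
    (hs : Summable fun n => a n * a' n) (ht : Summable fun n => b n * b' n) :
    traceValue a b a' b' e f e' f' ≤ ∑' n, (a n * a' n + b n * b' n) := by
  rw [hs.tsum_add ht]
  have h1 := h.pos.toReal_weightedSum_le h'.pos hs
  have h2 := h.neg.toReal_weightedSum_le h'.neg ht
  have h3 : 0 ≤ (weightedSum a b' (overlap e f')).toReal := ENNReal.toReal_nonneg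
  have h4 : 0 ≤ (weightedSum b a' (overlap f e')).toReal := ENNReal.toReal_nonneg
  unfold traceValue
  linarith

/-- The leading `n` eigenvectors of the positive and of the negative part, made orthonormal by
replacing those with eigenvalue zero. -/
lemma exists_orthonormal_sum [CompleteSpace H] (hdim : ¬ FiniteDimensional ℂ H)
    (h : SignedExpansion P N a b e f) (n : ℕ) :
    ∃ g : Fin n ⊕ Fin n → H, Orthonormal ℂ g ∧ (∀ j : Fin n, a j ≠ 0 → g (Sum.inl j) = e j) ∧
      ∀ j : Fin n, b j ≠ 0 → g (Sum.inr j) = f j := by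
  let v : Fin n ⊕ Fin n → H := Sum.elim (fun j => e j) fun j => f j
  let S : Set (Fin n ⊕ Fin n) := {x | Sum.elim (fun j : Fin n => a j) (fun j : Fin n => b j) x ≠ 0}
  have hv : Orthonormal ℂ fun i : S => v i := by
    constructor
    · rintro ⟨i | i, hi⟩
      · exact h.pos.orthonormal.1 i
      · exact h.neg.orthonormal.1 i
    · rintro ⟨i | i, hi⟩ ⟨j | j, hj⟩ hij
      · refine h.pos.orthonormal.2 fun hij' => hij ?_
        exact Subtype.ext (congrArg Sum.inl (Fin.ext hij'))
      · exact h.orthogonal i j hi hj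
      · exact inner_eq_zero_symm.1 (h.orthogonal j i hj hi)
      · refine h.neg.orthonormal.2 fun hij' => hij ?_
        exact Subtype.ext (congrArg Sum.inr (Fin.ext hij'))
  obtain ⟨g, hg, hgS⟩ := exists_orthonormal_extension hdim v S (Set.toFinite S) hv
  exact ⟨g, hg, fun j hj => hgS (Sum.inl j) hj, fun j hj => hgS (Sum.inr j) hj⟩

variable [CompleteSpace H]

lemma conj (h : SignedExpansion P N a b e f) (U : unitary (H →L[ℂ] H)) :
    SignedExpansion (star (U : H →L[ℂ] H) * P * (U : H →L[ℂ] H))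
      (star (U : H →L[ℂ] H) * N * (U : H →L[ℂ] H)) a b
      (fun n => star (U : H →L[ℂ] H) (e n)) (fun n => star (U : H →L[ℂ] H) (f n)) where
  pos := h.pos.conj U
  neg := h.neg.conj U
  orthogonal i j hi hj := by
    have hU : (U : H →L[ℂ] H) * star (U : H →L[ℂ] H) = 1 := Unitary.coe_mul_star_self U
    rw [ContinuousLinearMap.star_eq_adjoint, ContinuousLinearMap.adjoint_inner_left,
      ← ContinuousLinearMap.star_eq_adjoint, ← mul_apply_eq_comp, hU]
    exact h.orthogonal i j hi hj

lemma hasSum_trace (h : SignedExpansion P N a b e f) (h' : SignedExpansion P' N' a' b' e' f')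
    (h1 : Summable fun n => a n * a' n) (h2 : Summable fun n => b n * b' n)
    (h3 : Summable fun n => a n * b' n) (h4 : Summable fun n => b n * a' n)
    {ι : Type*} (v : HilbertBasis ι ℂ H) :
    HasSum (fun i => (inner ℂ (v i) (((P - N) * (P' - N')) (v i)) : ℂ))
      (traceValue a b a' b' e f e' f' : ℂ) := by
  have s1 := h.pos.hasSum_trace h'.pos (h.pos.tsum_ofReal_ne_top h'.pos h1) v
  have s2 := h.neg.hasSum_trace h'.neg (h.neg.tsum_ofReal_ne_top h'.neg h2) v
  have s3 := h.pos.hasSum_trace h'.neg (h.pos.tsum_ofReal_ne_top h'.neg h3) v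
  have s4 := h.neg.hasSum_trace h'.pos (h.neg.tsum_ofReal_ne_top h'.pos h4) v
  have s := ((s1.add s2).sub s3).sub s4
  unfold traceValue
  rw [Complex.ofReal_sub, Complex.ofReal_sub, Complex.ofReal_add]
  convert! s using 1
  funext i
  rw [mul_apply_eq_comp, sub_apply, sub_apply, map_sub, map_sub, inner_sub_right, inner_sub_right,
    inner_sub_right]
  ring

/-- A unitary matching the leading `n` eigenvectors of `P, N` with those of `P', N'` attains the
bound up to series of shifted sequences, which are small for large `n`. -/
lemma exists_unitary_le_traceValue (hdim : ¬ FiniteDimensional ℂ H)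
    (h : SignedExpansion P N a b e f) (h' : SignedExpansion P' N' a' b' e' f')
    (h1 : Summable fun n => a n * a' n) (h2 : Summable fun n => b n * b' n)
    (h3 : Summable fun n => a n * b' n) (h4 : Summable fun n => b n * a' n) (n : ℕ) :
    ∃ U : unitary (H →L[ℂ] H),
      ∑ j ∈ Finset.range n, (a j * a' j + b j * b' j) -
        (∑' j, a (j + n) * b' j + ∑' j, b' (j + n) * a j) -
        (∑' j, b (j + n) * a' j + ∑' j, a' (j + n) * b j) ≤
      traceValue a b a' b' e f (fun n => star (U : H →L[ℂ] H) (e' n))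
        (fun n => star (U : H →L[ℂ] H) (f' n)) := by
  obtain ⟨g, hg, hge, hgf⟩ := h.exists_orthonormal_sum hdim n
  obtain ⟨g', hg', hge', hgf'⟩ := h'.exists_orthonormal_sum hdim n
  obtain ⟨U, hU⟩ := exists_unitary_apply_eq hg hg'
  have hin : ∀ i j, inner ℂ (g i) (star (U : H →L[ℂ] H) (g' j)) = if i = j then (1 : ℂ) else 0 := by
    intro i j
    rw [ContinuousLinearMap.star_eq_adjoint, ContinuousLinearMap.adjoint_inner_right, hU]
    exact orthonormal_iff_ite.1 hg' i j
  have hc := h'.conj U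
  refine ⟨U, ?_⟩
  have b1 := h.pos.le_toReal_weightedSum_of_corner hc.pos h1 n fun j hj ha ha' => by
    have := hin (Sum.inl ⟨j, hj⟩) (Sum.inl ⟨j, hj⟩)
    rwa [hge ⟨j, hj⟩ ha, hge' ⟨j, hj⟩ ha', if_pos rfl] at this
  have b2 := h.neg.le_toReal_weightedSum_of_corner hc.neg h2 n fun j hj hb hb' => by
    have := hin (Sum.inr ⟨j, hj⟩) (Sum.inr ⟨j, hj⟩)
    rwa [hgf ⟨j, hj⟩ hb, hgf' ⟨j, hj⟩ hb', if_pos rfl] at this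
  have b3 := h.pos.toReal_weightedSum_le_of_corner hc.neg h3 n fun i hi j hj ha hb' => by
    have := hin (Sum.inl ⟨i, hi⟩) (Sum.inr ⟨j, hj⟩)
    rwa [hge ⟨i, hi⟩ ha, hgf' ⟨j, hj⟩ hb', if_neg Sum.inl_ne_inr] at this
  have b4 := h.neg.toReal_weightedSum_le_of_corner hc.pos h4 n fun i hi j hj hb ha' => by
    have := hin (Sum.inr ⟨i, hi⟩) (Sum.inl ⟨j, hj⟩)
    rwa [hgf ⟨i, hi⟩ hb, hge' ⟨j, hj⟩ ha', if_neg Sum.inr_ne_inl] at this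
  rw [Finset.sum_add_distrib]
  unfold traceValue
  linarith

lemma isLUB_traceValue (hdim : ¬ FiniteDimensional ℂ H)
    (h : SignedExpansion P N a b e f) (h' : SignedExpansion P' N' a' b' e' f')
    (h1 : Summable fun n => a n * a' n) (h2 : Summable fun n => b n * b' n)
    (h3 : Summable fun n => a n * b' n) (h4 : Summable fun n => b n * a' n) :
    IsLUB (Set.range fun U : unitary (H →L[ℂ] H) =>
        traceValue a b a' b' e f (fun n => star (U : H →L[ℂ] H) (e' n))
          (fun n => star (U : H →L[ℂ] H) (f' n)))
      (∑' n, (a n * a' n + b n * b' n)) := by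
  constructor
  · rintro _ ⟨U, rfl⟩
    exact h.traceValue_le (h'.conj U) h1 h2
  · intro M hM
    have t1 := (h1.add h2).hasSum.tendsto_sum_nat
    have t3 := (tendsto_tsum_shift_mul h.pos.antitone h.pos.tendsto h'.neg.nonneg h3).add
      (tendsto_tsum_shift_mul h'.neg.antitone h'.neg.tendsto h.pos.nonneg
        (by simpa only [mul_comm] using h3))
    have t4 := (tendsto_tsum_shift_mul h.neg.antitone h.neg.tendsto h'.pos.nonneg h4).add
      (tendsto_tsum_shift_mul h'.pos.antitone h'.pos.tendsto h.neg.nonneg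
        (by simpa only [mul_comm] using h4))
    have t := (t1.sub t3).sub t4
    rw [add_zero, sub_zero, sub_zero] at t
    refine le_of_tendsto' t fun n => ?_
    obtain ⟨U, hU⟩ := h.exists_unitary_le_traceValue hdim h' h1 h2 h3 h4 n
    exact hU.trans (hM ⟨U, rfl⟩)

/-- Exchanging the positive and the negative part of the second operator changes the sign of the
trace, so the infimum is the negative of a supremum. -/
lemma isGLB_traceValue (hdim : ¬ FiniteDimensional ℂ H)
    (h : SignedExpansion P N a b e f) (h' : SignedExpansion P' N' a' b' e' f')
    (h1 : Summable fun n => a n * a' n) (h2 : Summable fun n => b n * b' n)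
    (h3 : Summable fun n => a n * b' n) (h4 : Summable fun n => b n * a' n) :
    IsGLB (Set.range fun U : unitary (H →L[ℂ] H) =>
        traceValue a b a' b' e f (fun n => star (U : H →L[ℂ] H) (e' n))
          (fun n => star (U : H →L[ℂ] H) (f' n)))
      (-∑' n, (a n * b' n + b n * a' n)) := by
  have hs := (h.isLUB_traceValue hdim h'.swap h3 h4 h1 h2).neg
  rw [← Set.image_neg_eq_neg, ← Set.range_comp] at hs
  convert! hs using 3
  simp [traceValue_swap a b a' b']

end SignedExpansion

variable [CompleteSpace H]

lemma exists_signedExpansion (hdim : ¬ FiniteDimensional ℂ H) {C : H →L[ℂ] H}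
    (hc : IsCompactOperator C) (hC : IsSelfAdjoint C) :
    ∃ e f, SignedExpansion C⁺ C⁻ (eigDown C⁺) (eigDown C⁻) e f := by
  obtain ⟨e, he⟩ := exists_hasExpansion hdim (isCompactOperator_posPart hc hC)
    (isPositive_posPart C)
  obtain ⟨f, hf⟩ := exists_hasExpansion hdim (isCompactOperator_negPart hc hC)
    (isPositive_negPart C)
  refine ⟨e, f, he, hf, fun i j hi hj => ?_⟩
  have h1 : (inner ℂ (C⁺ (e i)) (C⁻ (f j)) : ℂ) = 0 := by
    rw [show (inner ℂ (C⁺ (e i)) (C⁻ (f j)) : ℂ) = inner ℂ (e i) (C⁺ (C⁻ (f j))) from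
      (isPositive_posPart C).isSymmetric _ _, ← mul_apply_eq_comp, CFC.posPart_mul_negPart]
    simp
  rw [he.apply_eq, hf.apply_eq, inner_smul_left, inner_smul_right] at h1
  simpa [hi, hj] using h1

/-- If the trace series has the same sum in every orthonormal basis, this sum is the trace. -/
lemma opTrace_eq {A : H →L[ℂ] H} {z : ℂ}
    (h : ∀ b : HilbertBasis (exists_hilbertBasis ℂ H).choose ℂ H,
      HasSum (fun i => inner ℂ (b i) (A (b i))) z) : opTrace A = z := by
  obtain ⟨b, hb⟩ := (exists_hilbertBasis ℂ H).choose_spec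
  rw [← (h b).tsum_eq, opTrace, hb]

end Optimization

end SchattenVonNeumann

end

theorem mainTheorem2 {H : Type*} [NormedAddCommGroup H] [InnerProductSpace ℂ H] [CompleteSpace H]
    [TopologicalSpace.SeparableSpace H] (hdim : ¬ FiniteDimensional ℂ H)
    (p q : ℝ≥0∞) (hpq : p⁻¹ + q⁻¹ = 1) (C T : H →L[ℂ] H)
    (hC : SchattenVonNeumann.IsSchatten p C) (hT : SchattenVonNeumann.IsSchatten q T)
    (hCsa : IsSelfAdjoint C) (hTsa : IsSelfAdjoint T) :
    -- all traces `tr(C U† T U)` are well defined, independently of the orthonormal basis, and real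
    (∀ U : unitary (H →L[ℂ] H),
      (∀ (ι : Type*) (b : HilbertBasis ι ℂ H),
        HasSum (fun i => inner ℂ (b i) ((C * star (U : H →L[ℂ] H) * T * (U : H →L[ℂ] H)) (b i)))
          (SchattenVonNeumann.opTrace (C * star (U : H →L[ℂ] H) * T * (U : H →L[ℂ] H)))) ∧
      (SchattenVonNeumann.opTrace (C * star (U : H →L[ℂ] H) * T * (U : H →L[ℂ] H))).im = 0) ∧
    -- the series on the right-hand sides converge
    Summable (fun j : ℕ =>
      SchattenVonNeumann.eigDown C⁺ j * SchattenVonNeumann.eigDown T⁺ j +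
        SchattenVonNeumann.eigDown C⁻ j * SchattenVonNeumann.eigDown T⁻ j) ∧
    Summable (fun j : ℕ =>
      SchattenVonNeumann.eigDown C⁺ j * SchattenVonNeumann.eigDown T⁻ j +
        SchattenVonNeumann.eigDown C⁻ j * SchattenVonNeumann.eigDown T⁺ j) ∧
    -- the supremum
    IsLUB (Set.range fun U : unitary (H →L[ℂ] H) =>
        (SchattenVonNeumann.opTrace (C * star (U : H →L[ℂ] H) * T * (U : H →L[ℂ] H))).re)
      (∑' j : ℕ, (SchattenVonNeumann.eigDown C⁺ j * SchattenVonNeumann.eigDown T⁺ j +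
        SchattenVonNeumann.eigDown C⁻ j * SchattenVonNeumann.eigDown T⁻ j)) ∧
    -- the infimum
    IsGLB (Set.range fun U : unitary (H →L[ℂ] H) =>
        (SchattenVonNeumann.opTrace (C * star (U : H →L[ℂ] H) * T * (U : H →L[ℂ] H))).re)
      (-∑' j : ℕ, (SchattenVonNeumann.eigDown C⁺ j * SchattenVonNeumann.eigDown T⁻ j +
        SchattenVonNeumann.eigDown C⁻ j * SchattenVonNeumann.eigDown T⁺ j)) ∧
    -- in particular, the bounds for `tr(C T)`
    (SchattenVonNeumann.opTrace (C * T)).im = 0 ∧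
    -∑' j : ℕ, (SchattenVonNeumann.eigDown C⁺ j * SchattenVonNeumann.eigDown T⁻ j +
        SchattenVonNeumann.eigDown C⁻ j * SchattenVonNeumann.eigDown T⁺ j)
      ≤ (SchattenVonNeumann.opTrace (C * T)).re ∧
    (SchattenVonNeumann.opTrace (C * T)).re
      ≤ ∑' j : ℕ, (SchattenVonNeumann.eigDown C⁺ j * SchattenVonNeumann.eigDown T⁺ j +
        SchattenVonNeumann.eigDown C⁻ j * SchattenVonNeumann.eigDown T⁻ j) := by
  obtain ⟨e, f, h⟩ := SchattenVonNeumann.exists_signedExpansion hdim hC.1 hCsa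
  obtain ⟨e', f', h'⟩ := SchattenVonNeumann.exists_signedExpansion hdim hT.1 hTsa
  have hsn := SchattenVonNeumann.summable_singularNumber_mul hpq hC hT
  -- The eigenvalues of the positive and negative parts are dominated by the singular numbers.
  have hsum : ∀ {a b : ℕ → ℝ}, (∀ n, 0 ≤ a n) → (∀ n, 0 ≤ b n) →
      (∀ n, a n ≤ SchattenVonNeumann.singularNumber C n) →
      (∀ n, b n ≤ SchattenVonNeumann.singularNumber T n) → Summable fun n => a n * b n :=
    fun ha hb ha' hb' => Summable.of_nonneg_of_le (fun n => mul_nonneg (ha n) (hb n))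
      (fun n => mul_le_mul (ha' n) (hb' n) (hb n) (SchattenVonNeumann.singularNumber_nonneg C n))
      hsn
  have cp := SchattenVonNeumann.eigDown_posPart_le_singularNumber hC.1 hCsa
  have cm := SchattenVonNeumann.eigDown_negPart_le_singularNumber hC.1 hCsa
  have tp := SchattenVonNeumann.eigDown_posPart_le_singularNumber hT.1 hTsa
  have tm := SchattenVonNeumann.eigDown_negPart_le_singularNumber hT.1 hTsa
  have h1 := hsum h.pos.nonneg h'.pos.nonneg cp tp
  have h2 := hsum h.neg.nonneg h'.neg.nonneg cm tm
  have h3 := hsum h.pos.nonneg h'.neg.nonneg cp tm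
  have h4 := hsum h.neg.nonneg h'.pos.nonneg cm tp
  have hop : ∀ U : unitary (H →L[ℂ] H), C * star (U : H →L[ℂ] H) * T * (U : H →L[ℂ] H) =
      (C⁺ - C⁻) * (star (U : H →L[ℂ] H) * T⁺ * (U : H →L[ℂ] H) -
        star (U : H →L[ℂ] H) * T⁻ * (U : H →L[ℂ] H)) := by
    intro U
    rw [CFC.posPart_sub_negPart C hCsa, ← sub_mul, ← mul_sub, CFC.posPart_sub_negPart T hTsa]
    simp only [mul_assoc]
  let R : unitary (H →L[ℂ] H) → ℝ := fun U =>
    SchattenVonNeumann.traceValue (SchattenVonNeumann.eigDown C⁺) (SchattenVonNeumann.eigDown C⁻)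
      (SchattenVonNeumann.eigDown T⁺) (SchattenVonNeumann.eigDown T⁻) e f
      (fun n => star (U : H →L[ℂ] H) (e' n)) (fun n => star (U : H →L[ℂ] H) (f' n))
  have htr : ∀ U : unitary (H →L[ℂ] H), SchattenVonNeumann.opTrace
      (C * star (U : H →L[ℂ] H) * T * (U : H →L[ℂ] H)) = (R U : ℂ) := fun U => by
    refine SchattenVonNeumann.opTrace_eq fun b => ?_
    rw [hop U]
    exact h.hasSum_trace (h'.conj U) h1 h2 h3 h4 b
  have hre : (fun U : unitary (H →L[ℂ] H) => (SchattenVonNeumann.opTrace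
      (C * star (U : H →L[ℂ] H) * T * (U : H →L[ℂ] H))).re) = R :=
    funext fun U => by rw [htr U, Complex.ofReal_re]
  have hlub := h.isLUB_traceValue hdim h' h1 h2 h3 h4
  have hglb := h.isGLB_traceValue hdim h' h1 h2 h3 h4
  have hone : C * T = C * star ((1 : unitary (H →L[ℂ] H)) : H →L[ℂ] H) * T *
      ((1 : unitary (H →L[ℂ] H)) : H →L[ℂ] H) := by simp
  refine ⟨fun U => ⟨fun ι b => ?_, ?_⟩, h1.add h2, h3.add h4, ?_, ?_, ?_, ?_, ?_⟩
  · rw [htr U, hop U]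
    exact h.hasSum_trace (h'.conj U) h1 h2 h3 h4 b
  · rw [htr U, Complex.ofReal_im]
  · rw [hre]
    exact hlub
  · rw [hre]
    exact hglb
  · rw [hone, htr, Complex.ofReal_im]
  · rw [hone, htr, Complex.ofReal_re]
    exact hglb.1 ⟨1, rfl⟩
  · rw [hone, htr, Complex.ofReal_re]
    exact hlub.1 ⟨1, rfl⟩
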